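/- Let $d\ge 1$. Consider the infinite spin chain with a copy of $\mathbb{C}^d$ at each site $i\in\mathbb{Z}$. Let $\mathcal{B}_0$ be the space of traceless operators on $\mathbb{C}^d$. A formal operator is a family $\Phi=\sum_A\Phi(A)$, indexed by the finite sets $A\subset\mathbb{Z}$, with $\Phi(A)\in\mathcal{B}_0^{\otimes A}$ (and $\mathcal{B}_0^{\otimes\emptyset}=\mathbb{C}$). It is Hermitian if every $\Phi(A)$ is. It is at most $r$-local if every $A$ with $\Phi(A)\neq 0$ is contained in $r$ contiguous sites, and local if this holds for some finite $r$. Let $\mathcal{T}$ be the translation by one site, so that $\mathcal{T}(\Phi)(A)$ is $\Phi(A+1)$ transported to $A$; $\Phi$ is translation-invariant if $\mathcal{T}(\Phi)=\Phi$. For a finite set $B\subset\mathbb{Z}$ put $\Phi|_B=\sum_{A\subset B}\Phi(A)$, an operator on $(\mathbb{C}^d)^{\otimes B}$. For local $\Phi$ the commutator $[\Phi,\Psi]$ is the formal operator whose component at $A$ is the $\mathcal{B}_0^{\otimes A}$-component of $[\Phi|_B,\Psi|_B]$ for all sufficiently large finite $B\supset A$. Let $\hat H$ be a local, Hermitian,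 translation-invariant formal operator (for instance a Hamiltonian with nearest-neighbour interactions and on-site potentials). Let $\hat B$ be a local Hermitian formal operator, not necessarily translation-invariant (for instance one that is at most two-local). Put $\hat Q^{(2)}=\hat H$ and $\hat Q^{(n+1)}=[\hat B,\hat Q^{(n)}]$ for $n\ge 2$, and $\hat X=\mathcal{T}(\hat B)-\hat B$. Suppose that $[\hat H,\hat Q^{(3)}]=0$, that $\hat X$ is translation-invariant, and that $[\hat X,[\hat B,\hat X]]=0$. Then for all $m,n\ge 2$ the operator $\hat Q^{(n)}$ is translation-invariant, $[\hat Q^{(m)},\hat Q^{(n)}]=0$, and $[\hat X,\hat Q^{(n)}]=0$. -/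

import Mathlib

open scoped Matrix

noncomputable section

namespace SpinChain

/-- Basis configurations of the sites in a finite set `A ⊂ ℤ`, each site carrying `ℂ^d` with its
standard basis. -/
abbrev Config (d : ℕ) (A : Finset ℤ) : Type := A → Fin d

/-- The algebra `𝓑^{⊗A}` of all linear operators on `(ℂ^d)^{⊗A}`, as matrices in the product
basis. -/
abbrev Op (d : ℕ) (A : Finset ℤ) : Type := Matrix (Config d A) (Config d A) ℂ

/-- `𝓑₀^{⊗A}` inside `𝓑^{⊗A}`: the operators whose partial trace over each single site of `A`
vanishes. For `A = ∅` this is all of `𝓑^{⊗∅} = ℂ`. -/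
def tracelessOp (d : ℕ) (A : Finset ℤ) : Submodule ℂ (Op d A) where
  carrier := {X | ∀ (a : A) (s t : Config d A),
    ∑ k : Fin d, X (Function.update s a k) (Function.update t a k) = 0}
  add_mem' := by
    intro X Y hX hY a s t
    simp only [Matrix.add_apply, Finset.sum_add_distrib]
    rw [hX a s t, hY a s t, add_zero]
  zero_mem' := by
    intro a s t
    simp
  smul_mem' := by
    intro c X hX a s t
    simp only [Matrix.smul_apply, ← Finset.smul_sum]
    rw [hX a s t, smul_zero]

/-- Formal operators `Φ = ∑_A Φ(A)` on the infinite chain: families `Φ(A) ∈ 𝓑₀^{⊗A}` indexed by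
the finite subsets `A ⊂ ℤ`, without any summability condition. -/
abbrev FormalOp (d : ℕ) : Type := (A : Finset ℤ) → tracelessOp d A

variable {d : ℕ}

/-! ### Adjoint, translation, range -/

/-- The adjoint `Φ† = ∑_A Φ(A)†`. -/
def adjoint (Φ : FormalOp d) : FormalOp d := fun A =>
  ⟨(Φ A : Op d A)ᴴ, by
    intro a s t
    have h := congrArg star ((Φ A).2 a t s)
    simpa [Matrix.conjTranspose_apply] using h⟩

/-- The translated set `A + x`. -/
def shiftSet (x : ℤ) (A : Finset ℤ) : Finset ℤ := A.map (Equiv.addRight x).toEmbedding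

/-- The bijection `a ↦ a + x` from `A` to `A + x`. -/
def shiftEquiv (x : ℤ) (A : Finset ℤ) : A ≃ shiftSet x A where
  toFun a := ⟨a + x, by simp [shiftSet]⟩
  invFun b := ⟨b - x, by
    obtain ⟨b, hb⟩ := b
    simp only [shiftSet, Finset.mem_map] at hb
    obtain ⟨c, hc, rfl⟩ := hb
    simpa using hc⟩
  left_inv a := by simp
  right_inv b := by simp

/-- The action on basis configurations of the unitary translation
`τ_A(x) : (ℂ^d)^{⊗A} → (ℂ^d)^{⊗(A+x)}`. -/
def shiftConfig (x : ℤ) (A : Finset ℤ) (s : Config d A) : Config d (shiftSet x A) :=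
  fun b => s ((shiftEquiv x A).symm b)

/-- The translation `𝒯(x)`, given by `𝒯(x)(Φ)(A) = τ_A(x)† Φ(A + x) τ_A(x)`. -/
def translate (x : ℤ) (Φ : FormalOp d) : FormalOp d := fun A =>
  ⟨(Φ (shiftSet x A) : Op d (shiftSet x A)).submatrix (shiftConfig x A) (shiftConfig x A), by
    intro a s t
    have key : ∀ (r : Config d A) (k : Fin d), shiftConfig x A (Function.update r a k)
        = Function.update (shiftConfig x A r) (shiftEquiv x A a) k := by
      intro r k
      funext b
      simp only [shiftConfig, Function.update_apply]
      congr 1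
      exact propext (Equiv.symm_apply_eq _)
    simp only [Matrix.submatrix_apply, key]
    exact (Φ (shiftSet x A)).2 _ _ _⟩

/-- `Φ` is translation invariant: `𝒯(Φ) = Φ` with `𝒯 = 𝒯(1)`. -/
def IsTranslationInvariant (Φ : FormalOp d) : Prop := translate 1 Φ = Φ

/-- `Φ` is Hermitian: `Φ† = Φ`. -/
def IsHermitian (Φ : FormalOp d) : Prop := adjoint Φ = Φ

/-- `Φ` is at most `r`-local: every `A` with `Φ(A) ≠ 0` lies in a block of at most `r` contiguous
sites, i.e. `A` is empty or `max A - min A + 1 ≤ r`. -/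
def IsAtMostLocal (r : ℕ) (Φ : FormalOp d) : Prop :=
  ∀ A : Finset ℤ, Φ A ≠ 0 → ∀ a ∈ A, ∀ b ∈ A, b - a + 1 ≤ (r : ℤ)

/-- `Φ` is local, i.e. of finite range: at most `r`-local for some finite `r`. -/
def IsLocal (Φ : FormalOp d) : Prop := ∃ r : ℕ, IsAtMostLocal r Φ

/-! ### Commutators -/

/-- Restriction of a configuration to a smaller set. -/
def resConfig {A B : Finset ℤ} (h : A ⊆ B) (s : Config d B) : Config d A :=
  fun a => s ⟨a, h a.2⟩

/-- The natural embedding `X ↦ X ⊗ I_{B \ A}` of `𝓑^{⊗A}` into `𝓑^{⊗B}` for `A ⊆ B`. -/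
def embed {A B : Finset ℤ} (h : A ⊆ B) (X : Op d A) : Op d B :=
  Matrix.of fun s t =>
    if ∀ b : B, (b : ℤ) ∉ A → s b = t b then X (resConfig h s) (resConfig h t) else 0

/-- The configuration on `B` equal to `s` on `C` and to `u` on `B \ C`. -/
def glue {C B : Finset ℤ} (s : Config d C) (u : {b : B // (b : ℤ) ∉ C} → Fin d) : Config d B :=
  fun b => if h : (b : ℤ) ∈ C then s ⟨b, h⟩ else u ⟨b, h⟩

/-- The normalized partial trace `d^{-|B \ C|} Tr_{B \ C} : 𝓑^{⊗B} → 𝓑^{⊗C}` for `C ⊆ B`. -/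
def partialTrace {C B : Finset ℤ} (_h : C ⊆ B) (Y : Op d B) : Op d C :=
  Matrix.of fun s t =>
    ((d : ℂ) ^ (B \ C).card)⁻¹ * ∑ u : {b : B // (b : ℤ) ∉ C} → Fin d, Y (glue s u) (glue t u)

/-- The projection `Y ↦ Y_A` from `𝓑^{⊗B} = ⨁_{A ⊆ B} 𝓑₀^{⊗A}` to the component `𝓑₀^{⊗A}`, by
inclusion-exclusion: `Y_A = ∑_{C ⊆ A} (-1)^{|A \ C|} d^{-|B \ C|} Tr_{B \ C}(Y) ⊗ I_{A \ C}`. -/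
def component {A B : Finset ℤ} (h : A ⊆ B) (Y : Op d B) : Op d A :=
  ∑ C ∈ A.powerset.attach, (-1 : ℂ) ^ (A \ C.1).card •
    embed (Finset.mem_powerset.1 C.2)
      (partialTrace ((Finset.mem_powerset.1 C.2).trans h) Y)

/-- The restriction `Φ|_B = ∑_{A ⊆ B} Φ(A) ∈ 𝓑^{⊗B}`. -/
def restrict (Φ : FormalOp d) (B : Finset ℤ) : Op d B :=
  ∑ A ∈ B.powerset.attach, embed (Finset.mem_powerset.1 A.2) (Φ A.1 : Op d A.1)

/-- `Z` is the value `[Φ, Ψ](A)`: it is `[Φ|_B, Ψ|_B]_A` for every sufficiently large finite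
`B ⊇ A`. -/
def IsCommValue (Φ Ψ : FormalOp d) (A : Finset ℤ) (Z : tracelessOp d A) : Prop :=
  ∃ B₀ : Finset ℤ, ∀ (B : Finset ℤ) (h : A ⊆ B), B₀ ⊆ B →
    component h (restrict Φ B * restrict Ψ B - restrict Ψ B * restrict Φ B) = (Z : Op d A)

open Classical in
/-- The commutator `[Φ, Ψ]`, with `[Φ, Ψ](A) = [Φ|_B, Ψ|_B]_A` for all sufficiently large finite
`B`. Such a value exists as soon as `Φ` is local, see `isCommValue_comm`; otherwise the default
value is `0`. -/
def comm (Φ Ψ : FormalOp d) : FormalOp d := fun A =>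
  if h : ∃ Z : tracelessOp d A, IsCommValue Φ Ψ A Z then h.choose else 0

/-! ### The commutator is well defined -/

theorem sum_update {ι : Type*} [Fintype ι] [DecidableEq ι] (a : ι) (f : (ι → Fin d) → ℂ) :
    ∑ u : ι → Fin d, ∑ k : Fin d, f (Function.update u a k) = d * ∑ u : ι → Fin d, f u := by
  have inv : Function.Involutive
      (fun p : (ι → Fin d) × Fin d => (Function.update p.1 a p.2, p.1 a)) := by
    rintro ⟨u, k⟩
    simp
  have e : ∑ p : (ι → Fin d) × Fin d, f (Function.update p.1 a p.2)
      = ∑ p : (ι → Fin d) × Fin d, f p.1 :=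
    Fintype.sum_equiv inv.toPerm _ (fun p => f p.1) (fun _ => rfl)
  rw [← Fintype.sum_prod_type' (fun u k => f (Function.update u a k)), e, Fintype.sum_prod_type]
  simp [Finset.mul_sum]

/-- Configurations on `B` are pairs of configurations on `C` and on `B \ C`. -/
def splitEquiv {C B : Finset ℤ} (h : C ⊆ B) :
    Config d C × ({b : B // (b : ℤ) ∉ C} → Fin d) ≃ Config d B where
  toFun p := glue p.1 p.2
  invFun w := (resConfig h w, fun b => w b.1)
  left_inv p := by
    ext1
    · funext a
      simp [resConfig, glue]
    · funext b
      simp [glue, b.2]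
  right_inv w := by
    funext b
    simp [resConfig, glue]

theorem sum_split {C B : Finset ℤ} (h : C ⊆ B) (f : Config d B → ℂ) :
    ∑ w, f w = ∑ s : Config d C, ∑ u : {b : B // (b : ℤ) ∉ C} → Fin d, f (glue s u) := by
  rw [← Fintype.sum_prod_type' (fun s u => f (glue s u))]
  exact (Fintype.sum_equiv (splitEquiv h) _ _ (fun _ => rfl)).symm

theorem resConfig_glue {C B : Finset ℤ} (h : C ⊆ B) (s : Config d C)
    (u : {b : B // (b : ℤ) ∉ C} → Fin d) : resConfig h (glue s u) = s := by
  funext a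
  simp [resConfig, glue]

theorem card_compl (C B : Finset ℤ) :
    Fintype.card {b : B // (b : ℤ) ∉ C} = (B \ C).card := by
  rw [← Fintype.card_coe]
  refine Fintype.card_congr ⟨fun b => ⟨b.1, by simp [b.2]⟩, fun b =>
    ⟨⟨b, (Finset.mem_sdiff.1 b.2).1⟩, (Finset.mem_sdiff.1 b.2).2⟩, ?_, ?_⟩
  · intro b; rfl
  · intro b; rfl

theorem embed_apply_glue {C B : Finset ℤ} (h : C ⊆ B) (X : Op d C) (s t : Config d C)
    (u v : {b : B // (b : ℤ) ∉ C} → Fin d) :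
    embed h X (glue s u) (glue t v) = if u = v then X s t else 0 := by
  simp only [embed, Matrix.of_apply, resConfig_glue]
  congr 1
  apply propext
  constructor
  · intro H
    funext b
    have := H b.1 b.2
    simpa [glue, b.2] using this
  · rintro rfl b hb
    simp [glue, hb]

theorem embed_add {A B : Finset ℤ} (h : A ⊆ B) (X Y : Op d A) :
    embed h (X + Y) = embed h X + embed h Y := by
  ext s t
  simp only [embed, Matrix.of_apply, Matrix.add_apply]
  split_ifs <;> simp

theorem embed_zero {A B : Finset ℤ} (h : A ⊆ B) : embed h (0 : Op d A) = 0 := by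
  ext s t
  simp [embed]

theorem embed_sum {A B : Finset ℤ} (h : A ⊆ B) {ι : Type*} (S : Finset ι) (f : ι → Op d A) :
    embed h (∑ i ∈ S, f i) = ∑ i ∈ S, embed h (f i) :=
  map_sum (⟨⟨embed h, embed_zero h⟩, embed_add h⟩ : Op d A →+ Op d B) f S

theorem embed_embed {A B C : Finset ℤ} (h : A ⊆ B) (h' : B ⊆ C) (X : Op d A) :
    embed h' (embed h X) = embed (h.trans h') X := by
  ext s t
  simp only [embed, Matrix.of_apply]
  rw [← ite_and]
  congr 1
  apply propext
  constructor
  · rintro ⟨h1, h2⟩ c hc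
    by_cases hb : (c : ℤ) ∈ B
    · exact h2 ⟨c, hb⟩ hc
    · exact h1 c hb
  · intro H
    exact ⟨fun c hc => H c (fun hA => hc (h hA)), fun b hb => H ⟨b, h' b.2⟩ hb⟩

theorem partialTrace_add {C B : Finset ℤ} (h : C ⊆ B) (X Y : Op d B) :
    partialTrace h (X + Y) = partialTrace h X + partialTrace h Y := by
  ext s t
  simp [partialTrace, Finset.sum_add_distrib, mul_add]

theorem partialTrace_sub {C B : Finset ℤ} (h : C ⊆ B) (X Y : Op d B) :
    partialTrace h (X - Y) = partialTrace h X - partialTrace h Y := by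
  ext s t
  simp [partialTrace, Finset.sum_sub_distrib, mul_sub]

theorem partialTrace_sum {C B : Finset ℤ} (h : C ⊆ B) {ι : Type*} (S : Finset ι)
    (f : ι → Op d B) : partialTrace h (∑ i ∈ S, f i) = ∑ i ∈ S, partialTrace h (f i) :=
  map_sum (⟨⟨partialTrace h, by ext s t; simp [partialTrace]⟩, partialTrace_add h⟩ :
    Op d B →+ Op d C) f S

theorem partialTrace_embed_mul {C B : Finset ℤ} (h : C ⊆ B) (X : Op d C) (Y : Op d B) :
    partialTrace h (embed h X * Y) = X * partialTrace h Y := by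
  ext s t
  simp only [partialTrace, Matrix.of_apply, Matrix.mul_apply]
  simp only [sum_split h, embed_apply_glue, ite_mul, zero_mul, Finset.sum_ite_eq,
    Finset.mem_univ, if_true]
  rw [Finset.sum_comm, Finset.mul_sum]
  refine Finset.sum_congr rfl fun w _ => ?_
  rw [← Finset.mul_sum]
  ring

theorem partialTrace_mul_embed {C B : Finset ℤ} (h : C ⊆ B) (X : Op d C) (Y : Op d B) :
    partialTrace h (Y * embed h X) = partialTrace h Y * X := by
  ext s t
  simp only [partialTrace, Matrix.of_apply, Matrix.mul_apply]
  simp only [sum_split h, embed_apply_glue, mul_ite, mul_zero, Finset.sum_ite_eq',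
    Finset.mem_univ, if_true]
  rw [Finset.sum_comm, Finset.mul_sum]
  refine Finset.sum_congr rfl fun w _ => ?_
  rw [← Finset.sum_mul]
  ring

theorem partialTrace_embed [NeZero d] {C B : Finset ℤ} (h : C ⊆ B) (X : Op d C) :
    partialTrace h (embed h X) = X := by
  ext s t
  have hd : (d : ℂ) ^ (B \ C).card ≠ 0 := pow_ne_zero _ (NeZero.ne _)
  simp only [partialTrace, Matrix.of_apply, embed_apply_glue, if_true, Finset.sum_const,
    Finset.card_univ, Fintype.card_fun, card_compl C B, Fintype.card_fin, nsmul_eq_mul,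
    Nat.cast_pow]
  rw [inv_mul_cancel_left₀ hd]

/-- The normalized partial trace as an average over all configurations of `B`. -/
theorem partialTrace_eq [NeZero d] {C B : Finset ℤ} (h : C ⊆ B) (Y : Op d B)
    (s t : Config d C) :
    partialTrace h Y s t = ((d : ℂ) ^ B.card)⁻¹ *
      ∑ w : Config d B, Y (glue s fun b => w b.1) (glue t fun b => w b.1) := by
  have hd : (d : ℂ) ≠ 0 := NeZero.ne _
  have hc : B.card = (B \ C).card + C.card := (Finset.card_sdiff_add_card_eq_card h).symm
  rw [sum_split h]
  have : ∀ (v : Config d C) (u : {b : B // (b : ℤ) ∉ C} → Fin d),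
      (fun b : {b : B // (b : ℤ) ∉ C} => (glue v u : Config d B) b.1) = u := by
    intro v u
    funext b
    simp [glue, b.2]
  simp only [this, Finset.sum_const, Finset.card_univ, Fintype.card_fun, Fintype.card_coe,
    Fintype.card_fin, nsmul_eq_mul, Nat.cast_pow, partialTrace, Matrix.of_apply]
  rw [hc, pow_add, mul_inv, mul_assoc, inv_mul_cancel_left₀ (pow_ne_zero _ hd)]

theorem partialTrace_partialTrace [NeZero d] {C D B : Finset ℤ} (h : C ⊆ D) (h' : D ⊆ B)
    (Y : Op d B) : partialTrace h (partialTrace h' Y) = partialTrace (h.trans h') Y := by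
  ext s t
  have hd : (d : ℂ) ≠ 0 := NeZero.ne _
  rw [partialTrace_eq, partialTrace_eq, sum_split h']
  simp only [partialTrace, Matrix.of_apply]
  rw [← Finset.mul_sum]
  have hc : B.card = (B \ D).card + D.card := (Finset.card_sdiff_add_card_eq_card h').symm
  rw [hc, pow_add, mul_inv]
  have : ∀ (r : Config d C) (v : Config d D) (u : {b : B // (b : ℤ) ∉ D} → Fin d),
      (glue (glue r fun b => v b.1 : Config d D) u : Config d B)
        = glue r fun b => (glue v u : Config d B) b.1 := by
    intro r v u
    funext b
    by_cases hC : (b : ℤ) ∈ C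
    · simp [glue, hC, h hC]
    · simp [glue, hC]
  simp only [this]
  ring

/-- Operators supported off `C` commute under the partial trace onto `C`. -/
theorem partialTrace_comm_of_disjoint {C D B : Finset ℤ} (hC : C ⊆ B) (hD : D ⊆ B)
    (hdisj : ∀ a ∈ D, a ∉ C) (X : Op d D) (Y : Op d B) :
    partialTrace hC (embed hD X * Y) = partialTrace hC (Y * embed hD X) := by
  ext s t
  have res : ∀ (r r' : Config d C) (u : {b : B // (b : ℤ) ∉ C} → Fin d),
      resConfig hD (glue r u) = resConfig hD (glue r' u) := by
    intro r r' u
    funext a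
    simp [resConfig, glue, hdisj a a.2]
  have e1 : ∀ (r r' : Config d C) (u v : {b : B // (b : ℤ) ∉ C} → Fin d), r ≠ r' →
      embed hD X (glue r u) (glue r' v) = 0 := by
    intro r r' u v hne
    simp only [embed, Matrix.of_apply]
    rw [if_neg]
    intro H
    apply hne
    funext c
    have := H ⟨c, hC c.2⟩ (fun hc => hdisj _ hc c.2)
    simpa [glue] using this
  have e2 : ∀ (r r' : Config d C) (u v : {b : B // (b : ℤ) ∉ C} → Fin d),
      embed hD X (glue r u) (glue r v) = embed hD X (glue r' u) (glue r' v) := by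
    intro r r' u v
    simp only [embed, Matrix.of_apply, res r r']
    congr 1
    apply propext
    refine forall_congr' fun b => forall_congr' fun _ => ?_
    by_cases hb : (b : ℤ) ∈ C <;> simp [glue, hb]
  simp only [partialTrace, Matrix.of_apply, Matrix.mul_apply]
  congr 1
  have l : ∀ u, ∑ w, embed hD X (glue s u) w * Y w (glue t u)
      = ∑ v, embed hD X (glue s u) (glue s v) * Y (glue s v) (glue t u) := by
    intro u
    rw [sum_split hC]
    refine Finset.sum_eq_single s (fun r _ hr => ?_) (by simp)
    simp [e1 s r _ _ hr.symm]
  have r : ∀ u, ∑ w, Y (glue s u) w * embed hD X w (glue t u)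
      = ∑ v, Y (glue s u) (glue t v) * embed hD X (glue t v) (glue t u) := by
    intro u
    rw [sum_split hC]
    refine Finset.sum_eq_single t (fun r _ hr => ?_) (by simp)
    simp [e1 r t _ _ hr]
  simp only [l, r]
  rw [Finset.sum_comm]
  refine Finset.sum_congr rfl fun u _ => Finset.sum_congr rfl fun v _ => ?_
  rw [e2 s t, mul_comm]

/-- An element of `𝓑₀^{⊗A}` has zero partial trace onto every set not containing `A`. -/
theorem partialTrace_embed_traceless [NeZero d] {A C B : Finset ℤ} (hA : A ⊆ B) (hC : C ⊆ B)
    (hAC : ¬ A ⊆ C) {X : Op d A} (hX : X ∈ tracelessOp d A) :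
    partialTrace hC (embed hA X) = 0 := by
  obtain ⟨a, haA, haC⟩ := Finset.not_subset.1 hAC
  have hd : (d : ℂ) ≠ 0 := NeZero.ne _
  ext s t
  simp only [partialTrace, Matrix.of_apply, Matrix.zero_apply]
  refine mul_eq_zero_of_right _ ?_
  have hsum := sum_update (d := d) (⟨⟨a, hA haA⟩, haC⟩ : {b : B // (b : ℤ) ∉ C})
    (fun u => embed hA X (glue s u) (glue t u))
  have hz : ∀ u : {b : B // (b : ℤ) ∉ C} → Fin d, ∑ k : Fin d,
      embed hA X (glue s (Function.update u ⟨⟨a, hA haA⟩, haC⟩ k))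
        (glue t (Function.update u ⟨⟨a, hA haA⟩, haC⟩ k)) = 0 := by
    intro u
    have res : ∀ (r : Config d C) (k : Fin d),
        resConfig hA (glue r (Function.update u ⟨⟨a, hA haA⟩, haC⟩ k))
          = Function.update (resConfig hA (glue r u)) ⟨a, haA⟩ k := by
      intro r k
      funext b
      by_cases hb : (b : ℤ) = a
      · have : b = ⟨a, haA⟩ := Subtype.ext hb
        subst this
        simp [resConfig, glue, haC]
      · have h1 : b ≠ ⟨a, haA⟩ := fun h => hb (congrArg Subtype.val h)
        by_cases hbC : (b : ℤ) ∈ C <;>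
          simp [resConfig, glue, hbC, h1, hb]
    have cond : ∀ k : Fin d, (∀ b : B, (b : ℤ) ∉ A →
        (glue s (Function.update u ⟨⟨a, hA haA⟩, haC⟩ k) : Config d B) b
          = (glue t (Function.update u ⟨⟨a, hA haA⟩, haC⟩ k) : Config d B) b) ↔
        (∀ b : B, (b : ℤ) ∉ A → (glue s u : Config d B) b = (glue t u : Config d B) b) := by
      intro k
      refine forall_congr' fun b => forall_congr' fun hb => ?_
      have hba : (b : ℤ) ≠ a := fun h => hb (h ▸ haA)
      have : b ≠ ⟨a, hA haA⟩ := fun h => hba (congrArg Subtype.val h)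
      by_cases hbC : (b : ℤ) ∈ C <;> simp [glue, hbC]
    simp only [embed, Matrix.of_apply, res, cond]
    split_ifs
    · exact hX ⟨a, haA⟩ _ _
    · simp
  rw [Finset.sum_eq_zero (fun u _ => hz u)] at hsum
  exact (mul_eq_zero.1 hsum.symm).resolve_left hd

theorem partialTrace_restrict [NeZero d] (Ψ : FormalOp d) {C B : Finset ℤ} (h : C ⊆ B) :
    partialTrace h (restrict Ψ B) = restrict Ψ C := by
  have e : ∀ A : B.powerset,
      partialTrace h (embed (Finset.mem_powerset.1 A.2) (Ψ A.1 : Op d A.1))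
        = if hA : A.1 ⊆ C then embed hA (Ψ A.1 : Op d A.1) else 0 := by
    intro A
    split_ifs with hA
    · rw [← embed_embed hA h, partialTrace_embed]
    · exact partialTrace_embed_traceless _ h hA (Ψ A.1).2
  rw [restrict, partialTrace_sum, Finset.sum_congr rfl fun A _ => e A]
  rw [Finset.sum_attach B.powerset
    (fun A => if hA : A ⊆ C then embed hA (Ψ A : Op d A) else 0)]
  rw [restrict, ← Finset.sum_subset (Finset.powerset_mono.2 h)]
  · rw [← Finset.sum_attach C.powerset]
    refine Finset.sum_congr rfl fun A _ => ?_
    rw [dif_pos (Finset.mem_powerset.1 A.2)]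
  · intro A _ hA
    rw [dif_neg (fun hc => hA (Finset.mem_powerset.2 hc))]

theorem restrict_split (Φ : FormalOp d) {C B : Finset ℤ} (h : C ⊆ B) :
    restrict Φ B = embed h (restrict Φ C) + ∑ A ∈ B.powerset.attach,
      if A.1 ⊆ C then 0 else embed (Finset.mem_powerset.1 A.2) (Φ A.1 : Op d A.1) := by
  have e : embed h (restrict Φ C) = ∑ A ∈ B.powerset.attach,
      if A.1 ⊆ C then embed (Finset.mem_powerset.1 A.2) (Φ A.1 : Op d A.1) else 0 := by
    have e1 : ∀ A : B.powerset,
        (if A.1 ⊆ C then embed (Finset.mem_powerset.1 A.2) (Φ A.1 : Op d A.1) else 0)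
        = if hA : A.1 ⊆ C then embed (hA.trans h) (Φ A.1 : Op d A.1) else 0 := by
      intro A
      split_ifs <;> rfl
    rw [Finset.sum_congr rfl fun A _ => e1 A, Finset.sum_attach B.powerset
      (fun A => if hA : A ⊆ C then embed (hA.trans h) (Φ A : Op d A) else 0),
      ← Finset.sum_subset (Finset.powerset_mono.2 h), restrict, embed_sum,
      ← Finset.sum_attach C.powerset]
    · refine Finset.sum_congr rfl fun A _ => ?_
      rw [dif_pos (Finset.mem_powerset.1 A.2), embed_embed]
    · intro A _ hA
      rw [dif_neg (fun hc => hA (Finset.mem_powerset.2 hc))]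
  rw [e, ← Finset.sum_add_distrib, restrict]
  refine Finset.sum_congr rfl fun A _ => ?_
  split_ifs <;> simp

/-- The component `Y_A` lies in `𝓑₀^{⊗A}`. -/
theorem component_mem [NeZero d] {A B : Finset ℤ} (h : A ⊆ B) (Y : Op d B) :
    component h Y ∈ tracelessOp d A := by
  intro a s t
  let ov : Finset ℤ → Config d A → Config d B → Config d B := fun C r w b =>
    if hb : (b : ℤ) ∈ C ∧ (b : ℤ) ∈ A then r ⟨b, hb.2⟩ else w b
  let T : Finset ℤ → Config d A → Config d A → ℂ := fun C s t =>
    if ∀ b : A, (b : ℤ) ∉ C → s b = t b then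
      ((d : ℂ) ^ B.card)⁻¹ * ∑ w : Config d B, Y (ov C s w) (ov C t w) else 0
  let S : Finset ℤ → ℂ := fun C =>
    ∑ k : Fin d, T C (Function.update s a k) (Function.update t a k)
  have hT : ∀ C : A.powerset, embed (Finset.mem_powerset.1 C.2)
      (partialTrace ((Finset.mem_powerset.1 C.2).trans h) Y) = Matrix.of (T C.1) := by
    rintro ⟨C, hC⟩
    have hC' := Finset.mem_powerset.1 hC
    ext s t
    simp only [embed, Matrix.of_apply, partialTrace_eq, T]
    have : ∀ (r : Config d A) (w : Config d B),
        (glue (resConfig hC' r) (fun b => w b.1) : Config d B) = ov C r w := by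
      intro r w
      funext b
      by_cases hb : (b : ℤ) ∈ C
      · simp [glue, ov, hb, hC' hb, resConfig]
      · simp [glue, ov, hb]
    simp only [this]
  have key : ∀ C : Finset ℤ, (a : ℤ) ∉ C → S (insert (a : ℤ) C) = S C := by
    intro C haC
    have c1 : ∀ k : Fin d, (∀ b : A, (b : ℤ) ∉ insert (a : ℤ) C →
        Function.update s a k b = Function.update t a k b) ↔
        (∀ b : A, (b : ℤ) ∉ C → Function.update s a k b = Function.update t a k b) := by
      intro k
      refine forall_congr' fun b => ?_
      by_cases hb : b = a
      · subst hb; simp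
      · simp [Subtype.coe_injective.eq_iff, hb]
    have c2 : ∀ k : Fin d, (∀ b : A, (b : ℤ) ∉ C →
        Function.update s a k b = Function.update t a k b) ↔
        (∀ b : A, (b : ℤ) ∉ C → b ≠ a → s b = t b) := by
      intro k
      refine forall_congr' fun b => forall_congr' fun _ => ?_
      by_cases hb : b = a
      · subst hb; simp
      · simp [hb]
    have o1 : ∀ (r : Config d A) (k : Fin d) (w : Config d B),
        ov (insert (a : ℤ) C) (Function.update r a k) w
          = ov C r (Function.update w ⟨a, h a.2⟩ k) := by
      intro r k w
      funext b
      by_cases hb : (b : ℤ) = a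
      · have : b = ⟨a, h a.2⟩ := Subtype.ext hb
        subst this
        simp [ov, haC]
      · have h1 : b ≠ ⟨a, h a.2⟩ := fun e => hb (congrArg Subtype.val e)
        by_cases hC : (b : ℤ) ∈ C
        · by_cases hA : (b : ℤ) ∈ A
          · have h2 : (⟨b, hA⟩ : A) ≠ a := fun e => hb (congrArg Subtype.val e)
            simp [ov, hC, hA, h2]
          · simp [ov, hA, h1]
        · simp [ov, hC, hb, h1]
    have o2 : ∀ (r : Config d A) (k : Fin d) (w : Config d B),
        ov C (Function.update r a k) w = ov C r w := by
      intro r k w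
      funext b
      by_cases hC : (b : ℤ) ∈ C
      · by_cases hA : (b : ℤ) ∈ A
        · have h2 : (⟨b, hA⟩ : A) ≠ a := by
            rintro rfl
            exact haC hC
          simp [ov, hC, hA, h2]
        · simp [ov, hA]
      · simp [ov, hC]
    simp only [S, T, c1, c2, o1, o2]
    split_ifs
    · rw [← Finset.mul_sum, Finset.sum_comm,
        sum_update (⟨a, h a.2⟩ : B) (fun w => Y (ov C s w) (ov C t w))]
      simp
      ring
    · rfl
  have goal : ∑ C ∈ A.powerset, (-1 : ℂ) ^ (A \ C).card * S C = 0 := by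
    have hA : insert (a : ℤ) (A.erase a) = A := Finset.insert_erase a.2
    rw [← hA, Finset.sum_powerset_insert (Finset.notMem_erase _ _), hA,
      ← Finset.sum_add_distrib]
    refine Finset.sum_eq_zero fun C hC => ?_
    have hC' := Finset.mem_powerset.1 hC
    have haC : (a : ℤ) ∉ C := fun e => Finset.notMem_erase _ _ (hC' e)
    rw [key C haC]
    have hcard : (A \ C).card = (A \ insert (a : ℤ) C).card + 1 := by
      have : A \ insert (a : ℤ) C = (A \ C).erase a := by
        ext x
        simp
        tauto
      rw [this, Finset.card_erase_add_one (by simp [haC])]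
    rw [hcard, pow_succ]
    ring
  rw [← goal, ← Finset.sum_attach A.powerset]
  simp only [component, hT, Matrix.sum_apply, Matrix.smul_apply, Matrix.of_apply, smul_eq_mul]
  rw [Finset.sum_comm]
  simp only [S, Finset.mul_sum]

/-- For local `Φ`, the value of `[Φ|_B, Ψ|_B]_A` does not depend on the choice of the
sufficiently large finite set `B`. -/
theorem exists_isCommValue [NeZero d] {Φ : FormalOp d} (hΦ : IsLocal Φ) (Ψ : FormalOp d)
    (A : Finset ℤ) : ∃ Z : tracelessOp d A, IsCommValue Φ Ψ A Z := by
  obtain ⟨r, hr⟩ := hΦ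
  let B₀ : Finset ℤ := A ∪ A.biUnion fun a => Finset.Icc (a - r) (a + r)
  have hA₀ : A ⊆ B₀ := Finset.subset_union_left
  have hfar : ∀ C : Finset ℤ, ¬ C ⊆ B₀ → Φ C ≠ 0 → ∀ c ∈ C, c ∉ A := by
    intro C hC hne c hc hcA
    apply hC
    intro x hx
    refine Finset.mem_union_right _ (Finset.mem_biUnion.2 ⟨c, hcA, Finset.mem_Icc.2 ?_⟩)
    have h1 := hr C hne c hc x hx
    have h2 := hr C hne x hx c hc
    omega
  refine ⟨⟨component hA₀
    (restrict Φ B₀ * restrict Ψ B₀ - restrict Ψ B₀ * restrict Φ B₀), component_mem _ _⟩,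
    B₀, fun B h hB => ?_⟩
  have main : ∀ (D : Finset ℤ) (hD : D ⊆ A),
      partialTrace (hD.trans h) (restrict Φ B * restrict Ψ B - restrict Ψ B * restrict Φ B)
      = partialTrace (hD.trans hA₀)
        (restrict Φ B₀ * restrict Ψ B₀ - restrict Ψ B₀ * restrict Φ B₀) := by
    intro D hD
    rw [restrict_split Φ hB]
    set R : Op d B := ∑ C ∈ B.powerset.attach,
      if C.1 ⊆ B₀ then 0 else embed (Finset.mem_powerset.1 C.2) (Φ C.1 : Op d C.1) with hR
    have hRc : partialTrace (hD.trans h) (R * restrict Ψ B)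
        = partialTrace (hD.trans h) (restrict Ψ B * R) := by
      rw [hR, Finset.sum_mul, Finset.mul_sum, partialTrace_sum, partialTrace_sum]
      refine Finset.sum_congr rfl fun C _ => ?_
      split_ifs with hC
      · simp
      · by_cases hne : Φ C.1 = 0
        · simp [hne, embed_zero]
        · exact partialTrace_comm_of_disjoint _ _
            (fun c hc hcD => hfar C.1 hC hne c hc (hD hcD)) _ _
    rw [add_mul, mul_add, partialTrace_sub, partialTrace_add, partialTrace_add, hRc,
      add_sub_add_right_eq_sub, ← partialTrace_sub,
      ← partialTrace_partialTrace (hD.trans hA₀) hB, partialTrace_sub hB,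
      partialTrace_embed_mul, partialTrace_mul_embed, partialTrace_restrict]
  simp only [component]
  refine Finset.sum_congr rfl fun D _ => ?_
  rw [main D.1 (Finset.mem_powerset.1 D.2)]

/-- For local `Φ`, the commutator `[Φ, Ψ]` is given by the defining formula. -/
theorem isCommValue_comm [NeZero d] {Φ : FormalOp d} (hΦ : IsLocal Φ) (Ψ : FormalOp d)
    (A : Finset ℤ) : IsCommValue Φ Ψ A (comm Φ Ψ A) := by
  have h := exists_isCommValue hΦ Ψ A
  have e : comm Φ Ψ A = h.choose := dif_pos h
  rw [e]
  exact h.choose_spec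

/-- The charges `Q⁽²⁾ = H` and `Q⁽ⁿ⁺¹⁾ = [B, Q⁽ⁿ⁾]`, for `n ≥ 2`. -/
def charge (B H : FormalOp d) (n : ℕ) : FormalOp d := (comm B)^[n - 2] H

theorem charge_two (B H : FormalOp d) : charge B H 2 = H := rfl

theorem charge_succ (B H : FormalOp d) {n : ℕ} (hn : 2 ≤ n) :
    charge B H (n + 1) = comm B (charge B H n) := by
  obtain ⟨k, rfl⟩ := Nat.exists_eq_add_of_le' hn
  exact Function.iterate_succ_apply' (comm B) k H

end SpinChain

end

/-!
For a local Hermitian translation-invariant `H`, the map `ad H` is self-adjoint for the positive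
form `⟨density Φ, Ψ⟩` (the Hilbert–Schmidt pairing per site) on translation-invariant local
operators, so `[H, [H, Y]] = 0` forces `[H, Y] = 0` for such `Y`. The rest takes place in the Lie
algebra of local formal operators. Translating `[H, [B, H]] = 0` gives `[H, [H, X]] = 0`, hence
`[H, X] = 0`. Since `𝒯(Q⁽ⁿ⁺¹⁾) = Q⁽ⁿ⁺¹⁾ + [X, Q⁽ⁿ⁾]`, translation invariance and `[X, Q⁽ⁿ⁾] = 0`
propagate together, the latter because `[X, [X, Q⁽ⁿ⁺¹⁾]] = 0`. Finally the brackets `[Q⁽ᵐ⁾, Q⁽ⁿ⁾]`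
with `m + n` fixed agree up to sign once those with smaller `m + n` vanish, and
`[H, [H, Q⁽ⁿ⁺¹⁾]] = -[H, [Q⁽³⁾, Q⁽ⁿ⁾]] = 0`.
-/

namespace SpinChain

section LieAlgebra

variable {R L : Type*} [CommRing R] [LieRing L] [LieAlgebra R L]

/-- `ad a` has no nilpotent part on the fixed points of `T`: an element of `ker (ad a) ^ 2` fixed
by `T` already lies in `ker (ad a)`. This is the part of semisimplicity that `ad` of a Hermitian
operator provides. -/
def IsAdReduced (T : L →ₗ⁅R⁆ L) (a : L) : Prop := ∀ y, T y = y → ⁅a, ⁅a, y⁆⁆ = 0 → ⁅a, y⁆ = 0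

variable {T : L →ₗ⁅R⁆ L} {b h : L}

theorem IsAdReduced.lie_sub_self_eq_zero (hh : IsAdReduced T h) (hT : T h = h)
    (hx : T (T b - b) = T b - b) (hb : ⁅h, ⁅b, h⁆⁆ = 0) : ⁅h, T b - b⁆ = 0 := by
  refine hh _ hx ?_
  have hTb : ⁅h, ⁅T b, h⁆⁆ = 0 := by
    simpa only [LieHom.map_lie, map_zero, hT] using congrArg T hb
  rw [← lie_skew h (T b - b), lie_neg, sub_lie, lie_sub, hTb, hb, sub_zero, neg_zero]

variable {q : ℕ → L}

theorem IsAdReduced.map_eq_and_lie_eq_zero (hx : IsAdReduced T (T b - b))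
    (hxb : ⁅T b - b, ⁅b, T b - b⁆⁆ = 0) (hq : ∀ n, q (n + 1) = ⁅b, q n⁆) (hT : T (q 0) = q 0)
    (hxq : ⁅T b - b, q 0⁆ = 0) (n : ℕ) : T (q n) = q n ∧ ⁅T b - b, q n⁆ = 0 := by
  induction n with
  | zero => exact ⟨hT, hxq⟩
  | succ n ih =>
    obtain ⟨hTn, hxn⟩ := ih
    have hTsucc : T (q (n + 1)) = q (n + 1) := by
      rw [hq, LieHom.map_lie, hTn, ← sub_eq_zero, ← sub_lie, hxn]
    refine ⟨hTsucc, hx _ hTsucc ?_⟩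
    have hbx : ⁅T b - b, ⁅T b - b, b⁆⁆ = 0 := by rw [← lie_skew _ b, lie_neg, hxb, neg_zero]
    rw [hq, leibniz_lie (T b - b) b, hxn, lie_zero, add_zero, leibniz_lie, hbx, hxn, zero_lie,
      lie_zero, add_zero]

/-- Applying `ad b` to `⁅q m, q n⁆ = 0` with `m + n = N` shows that all `⁅q m, q n⁆` with
`m + n = N + 1` agree up to sign. -/
theorem lie_eq_zero_of_level (hq : ∀ n, q (n + 1) = ⁅b, q n⁆) {N : ℕ}
    (hN : ∀ m n, m + n = N → ⁅q m, q n⁆ = 0) (h0 : ⁅q 0, q (N + 1)⁆ = 0) {m n : ℕ}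
    (hmn : m + n = N + 1) : ⁅q m, q n⁆ = 0 := by
  induction m generalizing n with
  | zero => rwa [← hmn, zero_add] at h0
  | succ m ih =>
    have hlevel := leibniz_lie b (q m) (q n)
    rwa [hN m n (by lia), lie_zero, ← hq, ← hq, ih (n := n + 1) (by lia), add_zero,
      eq_comm] at hlevel

theorem IsAdReduced.lie_eq_zero (hh : IsAdReduced T (q 0)) (hq : ∀ n, q (n + 1) = ⁅b, q n⁆)
    (hT : ∀ n, T (q n) = q n) (h01 : ⁅q 0, q 1⁆ = 0) (m n : ℕ) : ⁅q m, q n⁆ = 0 := by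
  suffices hN : ∀ N m n, m + n = N → ⁅q m, q n⁆ = 0 from hN _ m n rfl
  intro N
  induction N with
  | zero =>
    rintro m n hmn
    obtain ⟨rfl, rfl⟩ := Nat.add_eq_zero_iff.1 hmn
    exact lie_self _
  | succ N ih =>
    refine fun m n => lie_eq_zero_of_level hq ih (hh _ (hT _) ?_)
    have h0N : ⁅q 0, q N⁆ = 0 := ih 0 N (zero_add N)
    have hlevel : ⁅q 0, q (N + 1)⁆ = -⁅q 1, q N⁆ := by
      rw [eq_neg_iff_add_eq_zero, hq, hq, add_comm, ← leibniz_lie, h0N, lie_zero]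
    rw [hlevel, lie_neg, leibniz_lie, h01, h0N, zero_lie, lie_zero, add_zero, neg_zero]

end LieAlgebra

variable {d : ℕ}

attribute [local instance] LieRing.ofAssociativeRing

section Embed

variable {A B C : Finset ℤ}

theorem embed_self (h : A ⊆ A) (X : Op d A) : embed h X = X := by
  ext s t
  exact if_pos fun b hb => absurd b.2 hb

theorem embed_smul (h : A ⊆ B) (c : ℂ) (X : Op d A) : embed h (c • X) = c • embed h X := by
  ext s t
  simp only [embed, Matrix.of_apply, Matrix.smul_apply, smul_ite, smul_zero]

theorem embed_sub (h : A ⊆ B) (X Y : Op d A) : embed h (X - Y) = embed h X - embed h Y :=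
  map_sub (⟨⟨embed h, embed_zero h⟩, embed_add h⟩ : Op d A →+ Op d B) X Y

theorem op_ext_glue (h : A ⊆ B) {X Y : Op d B}
    (hXY : ∀ (s t : Config d A) (u v : {b : B // (b : ℤ) ∉ A} → Fin d),
      X (glue s u) (glue t v) = Y (glue s u) (glue t v)) : X = Y := by
  ext s t
  obtain ⟨⟨s, u⟩, rfl⟩ := (splitEquiv h).surjective s
  obtain ⟨⟨t, v⟩, rfl⟩ := (splitEquiv h).surjective t
  exact hXY s t u v

theorem embed_mul (h : A ⊆ B) (X Y : Op d A) : embed h (X * Y) = embed h X * embed h Y := by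
  refine op_ext_glue h fun s t u v => ?_
  simp only [Matrix.mul_apply, sum_split h, embed_apply_glue]
  by_cases huv : u = v <;> simp [huv]

theorem embed_lie (h : A ⊆ B) (X Y : Op d A) : embed h ⁅X, Y⁆ = ⁅embed h X, embed h Y⁆ := by
  rw [Ring.lie_def, Ring.lie_def, embed_sub, embed_mul, embed_mul]

theorem embed_conjTranspose (h : A ⊆ B) (X : Op d A) : embed h Xᴴ = (embed h X)ᴴ := by
  refine op_ext_glue h fun s t u v => ?_
  simp only [Matrix.conjTranspose_apply, embed_apply_glue, eq_comm (a := u), apply_ite star,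
    star_zero]

theorem embed_apply_glue_of_disjoint (hC : C ⊆ B) (hAB : A ⊆ B) (hAC : Disjoint A C)
    (Y : Op d C) (r s t : Config d A) (u v : {b : B // (b : ℤ) ∉ A} → Fin d) :
    embed hC Y (glue s u) (glue t v) =
      if s = t then embed hC Y (glue r u) (glue r v) else 0 := by
  have hres (p q : Config d A) (w : {b : B // (b : ℤ) ∉ A} → Fin d) :
      resConfig hC (glue p w) = resConfig hC (glue q w) := by
    funext c
    simp [resConfig, glue, Finset.disjoint_right.1 hAC c.2]
  split_ifs with hst
  · subst hst
    have hiff : (∀ b : B, (b : ℤ) ∉ C → glue s u b = glue s v b) ↔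
        ∀ b : B, (b : ℤ) ∉ C → glue r u b = glue r v b := by
      refine forall₂_congr fun b _ => ?_
      by_cases hb : (b : ℤ) ∈ A <;> simp [glue, hb]
    simp only [embed, Matrix.of_apply, hres s r, hiff]
  · refine if_neg fun hagree => hst (funext fun a => ?_)
    simpa [glue] using hagree ⟨a, hAB a.2⟩ (Finset.disjoint_left.1 hAC a.2)

theorem embed_lie_embed_of_disjoint (hA : A ⊆ B) (hC : C ⊆ B) (hAC : Disjoint A C)
    (X : Op d A) (Y : Op d C) : ⁅embed hA X, embed hC Y⁆ = 0 := by
  rw [Ring.lie_def, sub_eq_zero]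
  refine op_ext_glue hA fun s t u v => ?_
  obtain ⟨E, hE⟩ : ∃ E : _ → _ → ℂ, ∀ p q w x,
      embed hC Y (glue p w) (glue q x) = if p = q then E w x else 0 :=
    ⟨_, embed_apply_glue_of_disjoint hC hA hAC Y s⟩
  simp [Matrix.mul_apply, sum_split hA, embed_apply_glue, hE, mul_comm]

end Embed

section PartialTrace

variable {A B : Finset ℤ}

theorem partialTrace_smul (h : A ⊆ B) (c : ℂ) (Y : Op d B) :
    partialTrace h (c • Y) = c • partialTrace h Y := by
  ext s t
  simp only [partialTrace, Matrix.of_apply, Matrix.smul_apply, smul_eq_mul, ← Finset.mul_sum,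
    mul_left_comm]

theorem partialTrace_zero (h : A ⊆ B) : partialTrace h (0 : Op d B) = 0 := by
  simpa only [zero_smul] using partialTrace_smul h 0 (0 : Op d B)

theorem partialTrace_neg (h : A ⊆ B) (Y : Op d B) :
    partialTrace h (-Y) = -partialTrace h Y := by
  simpa only [neg_one_smul] using partialTrace_smul h (-1) Y

theorem partialTrace_embed_lie (h : A ⊆ B) (X : Op d A) (Y : Op d B) :
    partialTrace h ⁅embed h X, Y⁆ = ⁅X, partialTrace h Y⁆ := by
  rw [Ring.lie_def, Ring.lie_def, partialTrace_sub, partialTrace_embed_mul,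
    partialTrace_mul_embed]

end PartialTrace

section Restrict

theorem restrict_eq_sum (Φ : FormalOp d) (B : Finset ℤ) :
    restrict Φ B = ∑ A ∈ B.powerset, if h : A ⊆ B then embed h (Φ A : Op d A) else 0 := by
  rw [← Finset.sum_attach, restrict]
  exact Finset.sum_congr rfl fun A _ => by rw [dif_pos (Finset.mem_powerset.1 A.2)]

/-- Restriction to `B` as a linear map. -/
noncomputable def restrictₗ (B : Finset ℤ) : FormalOp d →ₗ[ℂ] Op d B where
  toFun Φ := restrict Φ B
  map_add' Φ Ψ := by simp [restrict, embed_add, Finset.sum_add_distrib]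
  map_smul' c Φ := by simp [restrict, embed_smul, Finset.smul_sum]

variable (Φ Ψ : FormalOp d) (B : Finset ℤ)

theorem restrict_zero : restrict (0 : FormalOp d) B = 0 := map_zero (restrictₗ B)

theorem restrict_add : restrict (Φ + Ψ) B = restrict Φ B + restrict Ψ B :=
  map_add (restrictₗ B) Φ Ψ

theorem restrict_sub : restrict (Φ - Ψ) B = restrict Φ B - restrict Ψ B :=
  map_sub (restrictₗ B) Φ Ψ

theorem restrict_neg : restrict (-Φ) B = -restrict Φ B := map_neg (restrictₗ B) Φ

theorem restrict_smul (c : ℂ) : restrict (c • Φ) B = c • restrict Φ B :=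
  map_smul (restrictₗ B) c Φ

theorem restrict_adjoint : restrict (adjoint Φ) B = (restrict Φ B)ᴴ := by
  simp only [restrict, Matrix.conjTranspose_sum, ← embed_conjTranspose]
  rfl

variable {Φ Ψ}

theorem restrict_eq_embed {A B : Finset ℤ} (h : A ⊆ B)
    (hΦ : ∀ C ⊆ B, Φ C ≠ 0 → C ⊆ A) : restrict Φ B = embed h (restrict Φ A) := by
  rw [restrict_split Φ h, add_eq_left]
  refine Finset.sum_eq_zero fun C _ => ?_
  split_ifs with hC
  · rfl
  · have hC0 : Φ C.1 = 0 := by_contra fun hne => hC (hΦ _ (Finset.mem_powerset.1 C.2) hne)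
    rw [hC0, ZeroMemClass.coe_zero, embed_zero]

theorem apply_eq_of_restrict_eq {A : Finset ℤ} (h : ∀ C ⊆ A, restrict Φ C = restrict Ψ C) :
    Φ A = Ψ A := by
  induction A using Finset.strongInduction with
  | H A ih =>
    have hproper : ∀ C ⊆ A, Φ C - Ψ C ≠ 0 → C = A := fun C hCA hne => by
      by_contra hC
      exact hne (sub_eq_zero.2 (ih C (hCA.ssubset_of_ne hC) fun D hD => h D (hD.trans hCA)))
    have hsum : restrict (Φ - Ψ) A = (Φ A - Ψ A : tracelessOp d A) := by
      rw [restrict_eq_sum, Finset.sum_eq_single_of_mem A (Finset.mem_powerset_self A),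
        dif_pos Finset.Subset.rfl, embed_self, Pi.sub_apply]
      intro C hC hCA
      have hC0 : (Φ - Ψ) C = 0 := by_contra fun hne =>
        hCA (hproper C (Finset.mem_powerset.1 hC) hne)
      simp only [hC0, ZeroMemClass.coe_zero, embed_zero, dite_eq_ite, ite_self]
    rw [restrict_sub, h A Finset.Subset.rfl, sub_self] at hsum
    exact sub_eq_zero.1 (Subtype.ext hsum.symm)

theorem restrict_injective (h : ∀ B, restrict Φ B = restrict Ψ B) : Φ = Ψ :=
  funext fun _ => apply_eq_of_restrict_eq fun C _ => h C

end Restrict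

section Component

theorem sum_powerset_sum_powerset_neg_one_pow {α R M : Type*} [DecidableEq α] [Ring R]
    [AddCommGroup M] [Module R M] (A : Finset α) (g : Finset α → M) :
    ∑ C ∈ A.powerset, ∑ D ∈ C.powerset, (-1 : R) ^ (C \ D).card • g D = g A := by
  induction A using Finset.induction_on generalizing g with
  | empty => simp
  | insert a A ha ih =>
    have hinsert : ∀ C ∈ A.powerset, ∑ D ∈ (insert a C).powerset,
        (-1 : R) ^ (insert a C \ D).card • g D
        = ∑ D ∈ C.powerset, (-1 : R) ^ (C \ D).card • g (insert a D)
          - ∑ D ∈ C.powerset, (-1 : R) ^ (C \ D).card • g D := by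
      intro C hC
      have haC : a ∉ C := fun h => ha (Finset.mem_powerset.1 hC h)
      rw [Finset.sum_powerset_insert haC, add_comm, sub_eq_add_neg, ← Finset.sum_neg_distrib]
      congr 1 <;> refine Finset.sum_congr rfl fun D hD => ?_
      · rw [Finset.insert_sdiff_insert, Finset.sdiff_insert_of_notMem haC]
      · have haD : a ∉ D := fun h => haC (Finset.mem_powerset.1 hD h)
        rw [Finset.insert_sdiff_of_notMem _ haD, Finset.card_insert_of_notMem (by simp [haC]),
          pow_succ, mul_neg_one, neg_smul]
    rw [Finset.sum_powerset_insert ha, Finset.sum_congr rfl hinsert, Finset.sum_sub_distrib,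
      add_sub_cancel, ih fun D => g (insert a D)]

variable {A B D : Finset ℤ}

theorem component_eq_sum (h : A ⊆ B) (Y : Op d B) :
    component h Y = ∑ C ∈ A.powerset, (-1 : ℂ) ^ (A \ C).card •
      if hC : C ⊆ A then embed hC (partialTrace (hC.trans h) Y) else 0 := by
  rw [← Finset.sum_attach, component]
  exact Finset.sum_congr rfl fun C _ => by rw [dif_pos (Finset.mem_powerset.1 C.2)]

theorem sum_embed_component (h : A ⊆ B) (Y : Op d B) :
    ∑ C ∈ A.powerset, (if hC : C ⊆ A then embed hC (component (hC.trans h) Y) else 0)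
      = partialTrace h Y := by
  let g (C : Finset ℤ) : Op d A :=
    if hC : C ⊆ A then embed hC (partialTrace (hC.trans h) Y) else 0
  have hg : ∀ C ∈ A.powerset,
      (if hC : C ⊆ A then embed hC (component (hC.trans h) Y) else 0)
        = ∑ D ∈ C.powerset, (-1 : ℂ) ^ (C \ D).card • g D := by
    intro C hC
    rw [Finset.mem_powerset] at hC
    rw [dif_pos hC, component_eq_sum, embed_sum]
    refine Finset.sum_congr rfl fun D hD => ?_
    rw [Finset.mem_powerset] at hD
    simp only [g, embed_smul, dif_pos hD, dif_pos (hD.trans hC), embed_embed]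
  rw [Finset.sum_congr rfl hg, sum_powerset_sum_powerset_neg_one_pow A g]
  exact (dif_pos Finset.Subset.rfl).trans (embed_self _ _)

theorem restrict_eq_partialTrace {Φ : FormalOp d} {A B : Finset ℤ} (h : A ⊆ B) {Y : Op d B}
    (hΦ : ∀ C, ∀ hC : C ⊆ A, (Φ C : Op d C) = component (hC.trans h) Y) :
    restrict Φ A = partialTrace h Y := by
  rw [restrict_eq_sum, ← sum_embed_component]
  refine Finset.sum_congr rfl fun C hC => ?_
  rw [Finset.mem_powerset] at hC
  rw [dif_pos hC, dif_pos hC, hΦ C hC]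

/-- The formal operator whose components are those of the operator `Z` on the sites of `D`. -/
noncomputable def ofOp [NeZero d] (Z : Op d D) : FormalOp d := fun A =>
  if h : A ⊆ D then ⟨component h Z, component_mem h Z⟩ else 0

theorem ofOp_apply [NeZero d] (h : A ⊆ D) (Z : Op d D) : (ofOp Z A : Op d A) = component h Z := by
  rw [ofOp, dif_pos h]

theorem ofOp_apply_eq_zero [NeZero d] (h : ¬A ⊆ D) (Z : Op d D) : ofOp Z A = 0 := dif_neg h

theorem restrict_ofOp_of_subset [NeZero d] (h : A ⊆ D) (Z : Op d D) :
    restrict (ofOp Z) A = partialTrace h Z :=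
  restrict_eq_partialTrace h fun _ hC => ofOp_apply (hC.trans h) Z

theorem restrict_ofOp [NeZero d] (h : D ⊆ B) (Z : Op d D) :
    restrict (ofOp Z) B = embed h Z := by
  have hD : restrict (ofOp Z) D = Z := by
    rw [restrict_ofOp_of_subset Finset.Subset.rfl]
    simpa only [embed_self] using partialTrace_embed Finset.Subset.rfl Z
  rw [restrict_eq_embed h, hD]
  exact fun C _ hne => by_contra fun hC => hne (ofOp_apply_eq_zero hC Z)

theorem component_restrict [NeZero d] (Φ : FormalOp d) (h : A ⊆ B) :
    component h (restrict Φ B) = Φ A := by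
  rw [← ofOp_apply h]
  refine congrArg Subtype.val (apply_eq_of_restrict_eq fun C hC => ?_)
  rw [restrict_ofOp_of_subset (hC.trans h), partialTrace_restrict]

theorem component_zero (h : A ⊆ B) : component h (0 : Op d B) = 0 := by
  simp only [component, partialTrace_zero, embed_zero, smul_zero, Finset.sum_const_zero]

theorem component_sum (h : A ⊆ B) {ι : Type*} (S : Finset ι) (f : ι → Op d B) :
    component h (∑ i ∈ S, f i) = ∑ i ∈ S, component h (f i) := by
  simp only [component, partialTrace_sum, embed_sum, Finset.smul_sum]
  exact Finset.sum_comm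

theorem component_embed_eq_zero [NeZero d] (hA : A ⊆ B) (hD : D ⊆ B) (hAD : ¬A ⊆ D)
    (Z : Op d D) : component hA (embed hD Z) = 0 := by
  rw [← restrict_ofOp hD, component_restrict, ofOp_apply_eq_zero hAD, ZeroMemClass.coe_zero]

end Component

section Commutator

variable {Φ Ψ Ω : FormalOp d} {A B N : Finset ℤ}

/-- `N` contains `A` together with all sets meeting `A` on which `Φ` has a nonzero term. Terms of
`Φ` outside such an `N` do not contribute to commutators on `A`. -/
def IsNbhd (Φ : FormalOp d) (A N : Finset ℤ) : Prop :=
  A ⊆ N ∧ ∀ C, Φ C ≠ 0 → ¬Disjoint C A → C ⊆ N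

theorem IsNbhd.mono (hN : IsNbhd Φ A N) (hB : N ⊆ B) : IsNbhd Φ A B :=
  ⟨hN.1.trans hB, fun C hC hCA => (hN.2 C hC hCA).trans hB⟩

theorem IsLocal.exists_isNbhd (hΦ : IsLocal Φ) (A : Finset ℤ) : ∃ N, IsNbhd Φ A N := by
  obtain ⟨r, hr⟩ := hΦ
  refine ⟨A ∪ A.biUnion fun a => Finset.Icc (a - r) (a + r), Finset.subset_union_left,
    fun C hC hCA c hc => Finset.mem_union_right _ ?_⟩
  obtain ⟨a, haC, haA⟩ := Finset.not_disjoint_iff.1 hCA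
  have hac := hr C hC a haC c hc
  have hca := hr C hC c hc a haC
  exact Finset.mem_biUnion.2 ⟨a, haA, Finset.mem_Icc.2 ⟨by lia, by lia⟩⟩

theorem IsNbhd.partialTrace_lie_eq_embed (hN : IsNbhd Φ A N) (hB : N ⊆ B) (Y : Op d B) :
    partialTrace (hN.1.trans hB) ⁅restrict Φ B, Y⁆
      = partialTrace (hN.1.trans hB) ⁅embed hB (restrict Φ N), Y⁆ := by
  rw [restrict_split Φ hB, add_lie, partialTrace_add, add_eq_left, sum_lie, partialTrace_sum]
  refine Finset.sum_eq_zero fun C _ => ?_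
  split_ifs with hC
  · rw [zero_lie, partialTrace_zero]
  · by_cases hne : Φ C.1 = 0
    · rw [hne, ZeroMemClass.coe_zero, embed_zero, zero_lie, partialTrace_zero]
    · have hCA : Disjoint C.1 A := not_not.1 fun hmeet => hC (hN.2 C.1 hne hmeet)
      rw [Ring.lie_def, partialTrace_sub, sub_eq_zero]
      exact partialTrace_comm_of_disjoint _ _ (fun _ h => Finset.disjoint_left.1 hCA h) _ _

theorem IsNbhd.partialTrace_lie [NeZero d] (hN : IsNbhd Φ A N) (hB : N ⊆ B)
    (Y : Op d B) : partialTrace (hN.1.trans hB) ⁅restrict Φ B, Y⁆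
      = partialTrace hN.1 ⁅restrict Φ N, partialTrace hB Y⁆ := by
  rw [hN.partialTrace_lie_eq_embed hB, ← partialTrace_partialTrace hN.1 hB,
    partialTrace_embed_lie]

theorem eventually_component_lie [NeZero d] (hΦ : IsLocal Φ) (Ψ : FormalOp d) (A : Finset ℤ) :
    ∀ᶠ B in Filter.atTop, ∀ h : A ⊆ B,
      component h ⁅restrict Φ B, restrict Ψ B⁆ = (comm Φ Ψ A : Op d A) := by
  obtain ⟨B₀, hB₀⟩ := isCommValue_comm hΦ Ψ A
  filter_upwards [Filter.eventually_ge_atTop B₀] with B hB h using hB₀ B h hB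

theorem restrict_comm [NeZero d] (hΦ : IsLocal Φ) (Ψ : FormalOp d) (hN : IsNbhd Φ A N) :
    restrict (comm Φ Ψ) A = partialTrace hN.1 ⁅restrict Φ N, restrict Ψ N⁆ := by
  obtain ⟨B, hB, hNB⟩ := ((A.powerset.eventually_all.2 fun C _ =>
    eventually_component_lie hΦ Ψ C).and (Filter.eventually_ge_atTop N)).exists
  rw [← partialTrace_restrict Ψ hNB, ← hN.partialTrace_lie hNB]
  exact restrict_eq_partialTrace _ fun C hC =>
    (hB C (Finset.mem_powerset.2 hC) (hC.trans (hN.1.trans hNB))).symm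

theorem eventually_restrict_comm_comm [NeZero d] (hΦ : IsLocal Φ) (hΨ : IsLocal Ψ)
    (Ω : FormalOp d) (A : Finset ℤ) : ∀ᶠ B in Filter.atTop, ∀ h : A ⊆ B,
      restrict (comm Φ (comm Ψ Ω)) A
        = partialTrace h ⁅restrict Φ B, ⁅restrict Ψ B, restrict Ω B⁆⁆ := by
  obtain ⟨N, hN⟩ := hΦ.exists_isNbhd A
  obtain ⟨M, hM⟩ := hΨ.exists_isNbhd N
  filter_upwards [Filter.eventually_ge_atTop M] with B hB _
  have hNB := hM.mono hB
  rw [restrict_comm hΦ _ hN, restrict_comm hΨ _ hNB, hN.partialTrace_lie hNB.1]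

theorem component_lie_embed_eq_zero [NeZero d] {C D : Finset ℤ} (hA : A ⊆ B) (hC : C ⊆ B)
    (hD : D ⊆ B) (h : ¬Disjoint C D → ¬A ⊆ C ∪ D) (X : Op d C) (Y : Op d D) :
    component hA ⁅embed hC X, embed hD Y⁆ = 0 := by
  by_cases hCD : Disjoint C D
  · rw [embed_lie_embed_of_disjoint hC hD hCD, component_zero]
  · rw [← embed_embed Finset.subset_union_left (Finset.union_subset hC hD) X,
      ← embed_embed Finset.subset_union_right (Finset.union_subset hC hD) Y, ← embed_lie,
      component_embed_eq_zero hA _ (h hCD)]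

theorem exists_of_comm_apply_ne_zero [NeZero d] (hΦ : IsLocal Φ) (hA : comm Φ Ψ A ≠ 0) :
    ∃ C D, Φ C ≠ 0 ∧ Ψ D ≠ 0 ∧ ¬Disjoint C D ∧ A ⊆ C ∪ D := by
  contrapose! hA
  obtain ⟨B, hB, hAB⟩ :=
    ((eventually_component_lie hΦ Ψ A).and (Filter.eventually_ge_atTop A)).exists
  refine Subtype.ext ((hB hAB).symm.trans ?_)
  simp only [restrict, sum_lie, lie_sum, component_sum]
  refine Finset.sum_eq_zero fun D _ => Finset.sum_eq_zero fun C _ => ?_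
  by_cases hC : Φ C.1 = 0
  · simp only [hC, ZeroMemClass.coe_zero, embed_zero, zero_lie, component_zero]
  by_cases hD : Ψ D.1 = 0
  · simp only [hD, ZeroMemClass.coe_zero, embed_zero, lie_zero, component_zero]
  exact component_lie_embed_eq_zero _ _ _ (hA C.1 D.1 hC hD) _ _

theorem IsLocal.comm [NeZero d] (hΦ : IsLocal Φ) (hΨ : IsLocal Ψ) : IsLocal (comm Φ Ψ) := by
  obtain ⟨r, hr⟩ := id hΦ
  obtain ⟨s, hs⟩ := hΨ
  refine ⟨r + s, fun A hA a ha b hb => ?_⟩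
  obtain ⟨C, D, hC, hD, hCD, hACD⟩ := exists_of_comm_apply_ne_zero hΦ hA
  obtain ⟨x, hxC, hxD⟩ := Finset.not_disjoint_iff.1 hCD
  have hC' := hr C hC
  have hD' := hs D hD
  push_cast
  rcases Finset.mem_union.1 (hACD ha) with ha | ha <;>
    rcases Finset.mem_union.1 (hACD hb) with hb | hb
  · linarith [hC' a ha b hb, hD' x hxD x hxD]
  · linarith [hC' a ha x hxC, hD' x hxD b hb]
  · linarith [hD' a ha x hxD, hC' x hxC b hb]
  · linarith [hD' a ha b hb, hC' x hxC x hxC]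

theorem comm_add_right [NeZero d] (hΦ : IsLocal Φ) (Ψ Ω : FormalOp d) :
    comm Φ (Ψ + Ω) = comm Φ Ψ + comm Φ Ω := by
  refine restrict_injective fun A => ?_
  obtain ⟨N, hN⟩ := hΦ.exists_isNbhd A
  simp only [restrict_add, restrict_comm hΦ _ hN, lie_add, partialTrace_add]

theorem comm_smul_right [NeZero d] (hΦ : IsLocal Φ) (c : ℂ) (Ψ : FormalOp d) :
    comm Φ (c • Ψ) = c • comm Φ Ψ := by
  refine restrict_injective fun A => ?_
  obtain ⟨N, hN⟩ := hΦ.exists_isNbhd A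
  simp only [restrict_smul, restrict_comm hΦ _ hN, lie_smul, partialTrace_smul]

theorem comm_self [NeZero d] (hΦ : IsLocal Φ) : comm Φ Φ = 0 := by
  refine restrict_injective fun A => ?_
  obtain ⟨N, hN⟩ := hΦ.exists_isNbhd A
  rw [restrict_comm hΦ _ hN, lie_self, partialTrace_zero, restrict_zero]

theorem comm_swap [NeZero d] (hΦ : IsLocal Φ) (hΨ : IsLocal Ψ) :
    comm Φ Ψ = -comm Ψ Φ := by
  refine restrict_injective fun A => ?_
  obtain ⟨N, hN⟩ := hΦ.exists_isNbhd A
  obtain ⟨M, hM⟩ := hΨ.exists_isNbhd A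
  rw [restrict_neg, restrict_comm hΦ _ (hN.mono Finset.subset_union_left),
    restrict_comm hΨ _ (hM.mono Finset.subset_union_right), ← partialTrace_neg, lie_skew]

theorem comm_add_left [NeZero d] (hΦ : IsLocal Φ) (hΨ : IsLocal Ψ) (hΩ : IsLocal Ω)
    (hΦΨ : IsLocal (Φ + Ψ)) : comm (Φ + Ψ) Ω = comm Φ Ω + comm Ψ Ω := by
  rw [comm_swap hΦΨ hΩ, comm_add_right hΩ, comm_swap hΦ hΩ, comm_swap hΨ hΩ, neg_add]

theorem comm_comm [NeZero d] (hΦ : IsLocal Φ) (hΨ : IsLocal Ψ) (hΩ : IsLocal Ω) :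
    comm Φ (comm Ψ Ω) = comm (comm Φ Ψ) Ω + comm Ψ (comm Φ Ω) := by
  rw [comm_swap (hΦ.comm hΨ) hΩ]
  refine restrict_injective fun A => ?_
  obtain ⟨B, ⟨⟨hΦΨΩ, hΩΦΨ⟩, hΨΦΩ⟩, hAB⟩ :=
    ((((eventually_restrict_comm_comm hΦ hΨ Ω A).and
      (eventually_restrict_comm_comm hΩ hΦ Ψ A)).and
      (eventually_restrict_comm_comm hΨ hΦ Ω A)).and (Filter.eventually_ge_atTop A)).exists
  rw [restrict_add, restrict_neg, hΦΨΩ hAB, hΩΦΨ hAB, hΨΦΩ hAB, ← partialTrace_neg, lie_skew,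
    ← partialTrace_add, ← leibniz_lie]

/-- The space of local formal operators. -/
def localOp (d : ℕ) : Submodule ℂ (FormalOp d) where
  carrier := {Φ | IsLocal Φ}
  zero_mem' := ⟨0, fun _ hA => absurd rfl hA⟩
  add_mem' := by
    rintro Φ Ψ ⟨r, hr⟩ ⟨s, hs⟩
    refine ⟨max r s, fun A hA a ha b hb => ?_⟩
    have hΦΨ : Φ A ≠ 0 ∨ Ψ A ≠ 0 := by
      contrapose! hA
      rw [Pi.add_apply, hA.1, hA.2, add_zero]
    rw [Nat.cast_max, le_max_iff]
    exact hΦΨ.imp (fun h => hr A h a ha b hb) fun h => hs A h a ha b hb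
  smul_mem' c Φ := by
    rintro ⟨r, hr⟩
    exact ⟨r, fun A hA => hr A fun h => hA (by rw [Pi.smul_apply, h, smul_zero])⟩

variable [NeZero d]

noncomputable instance : LieRing (localOp d) where
  bracket Φ Ψ := ⟨comm Φ Ψ, Φ.2.comm Ψ.2⟩
  add_lie Φ Ψ Ω := Subtype.ext (comm_add_left Φ.2 Ψ.2 Ω.2 (Φ + Ψ).2)
  lie_add Φ Ψ Ω := Subtype.ext (comm_add_right Φ.2 Ψ Ω)
  lie_self Φ := Subtype.ext (comm_self Φ.2)
  leibniz_lie Φ Ψ Ω := Subtype.ext (comm_comm Φ.2 Ψ.2 Ω.2)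

noncomputable instance : LieAlgebra ℂ (localOp d) where
  lie_smul c Φ Ψ := Subtype.ext (comm_smul_right Φ.2 c Ψ)

end Commutator

section Translate

variable (x y : ℤ) {A B N : Finset ℤ} {Φ Ψ : FormalOp d}

theorem mem_shiftSet {x a : ℤ} : a ∈ shiftSet x A ↔ a - x ∈ A := Finset.mem_map_equiv

theorem add_mem_shiftSet {x a : ℤ} : a + x ∈ shiftSet x A ↔ a ∈ A := by
  rw [mem_shiftSet, add_sub_cancel_right]

theorem shiftSet_subset_shiftSet : shiftSet x A ⊆ shiftSet x B ↔ A ⊆ B := Finset.map_subset_map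

theorem bijective_shiftSet : Function.Bijective (shiftSet x) :=
  (Equiv.addRight x).finsetCongr.bijective

theorem shiftSet_shiftSet (A : Finset ℤ) : shiftSet y (shiftSet x A) = shiftSet (x + y) A := by
  ext a
  rw [mem_shiftSet, mem_shiftSet, mem_shiftSet, sub_sub, add_comm]

theorem shiftSet_zero (A : Finset ℤ) : shiftSet 0 A = A := by
  ext a
  rw [mem_shiftSet, sub_zero]

/-- Conjugation `Y ↦ τ_A(x)† Y τ_A(x)` by the translation `τ_A(x)`. -/
def pull (x : ℤ) (A : Finset ℤ) : Op d (shiftSet x A) ≃ₐ[ℂ] Op d A :=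
  Matrix.reindexAlgEquiv ℂ ℂ ((shiftEquiv x A).arrowCongr (Equiv.refl (Fin d))).symm

theorem pull_apply (Y : Op d (shiftSet x A)) :
    pull x A Y = Y.submatrix (shiftConfig x A) (shiftConfig x A) := rfl

theorem pull_conjTranspose (Y : Op d (shiftSet x A)) : pull x A Yᴴ = (pull x A Y)ᴴ := rfl

theorem pull_lie (Y Z : Op d (shiftSet x A)) : pull x A ⁅Y, Z⁆ = ⁅pull x A Y, pull x A Z⁆ := by
  rw [Ring.lie_def, Ring.lie_def, map_sub, map_mul, map_mul]

theorem pull_embed (h : A ⊆ B) (Y : Op d (shiftSet x A)) :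
    pull x B (embed ((shiftSet_subset_shiftSet x).2 h) Y) = embed h (pull x A Y) := by
  ext s t
  simp only [pull_apply, embed, Matrix.of_apply, Matrix.submatrix_apply]
  refine if_congr ?_ rfl rfl
  rw [← (shiftEquiv x B).forall_congr_right]
  refine forall_congr' fun b => ?_
  change ((b : ℤ) + x ∉ shiftSet x A → _) ↔ _
  rw [add_mem_shiftSet, shiftConfig, shiftConfig, Equiv.symm_apply_apply]

theorem translate_apply (Φ : FormalOp d) (A : Finset ℤ) :
    (translate x Φ A : Op d A) = pull x A (Φ (shiftSet x A)) := rfl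

theorem translate_apply_eq_zero_iff : translate x Φ A = 0 ↔ Φ (shiftSet x A) = 0 := by
  rw [← Subtype.coe_inj, ← Subtype.coe_inj, translate_apply, ZeroMemClass.coe_zero,
    EmbeddingLike.map_eq_zero_iff, ZeroMemClass.coe_zero]

theorem restrict_translate (Φ : FormalOp d) (B : Finset ℤ) :
    restrict (translate x Φ) B = pull x B (restrict Φ (shiftSet x B)) := by
  rw [restrict_eq_sum, restrict_eq_sum, map_sum]
  refine Finset.sum_bijective (shiftSet x) (bijective_shiftSet x) (fun A => ?_) fun A hA => ?_
  · rw [Finset.mem_powerset, Finset.mem_powerset, shiftSet_subset_shiftSet]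
  · have h := Finset.mem_powerset.1 hA
    rw [dif_pos h, dif_pos ((shiftSet_subset_shiftSet x).2 h), translate_apply, pull_embed]

theorem pull_partialTrace [NeZero d] (h : A ⊆ B) (Y : Op d (shiftSet x B)) :
    pull x A (partialTrace ((shiftSet_subset_shiftSet x).2 h) Y)
      = partialTrace h (pull x B Y) := by
  obtain ⟨Φ, rfl⟩ : ∃ Φ : FormalOp d, restrict Φ (shiftSet x B) = Y :=
    ⟨ofOp Y, (restrict_ofOp Finset.Subset.rfl Y).trans (embed_self _ Y)⟩
  rw [partialTrace_restrict, ← restrict_translate, ← restrict_translate, partialTrace_restrict]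

theorem IsLocal.translate (hΦ : IsLocal Φ) : IsLocal (translate x Φ) := by
  obtain ⟨r, hr⟩ := hΦ
  refine ⟨r, fun A hA a ha b hb => ?_⟩
  have hab := hr _ (mt (translate_apply_eq_zero_iff x).2 hA) _ (add_mem_shiftSet.2 ha) _
    (add_mem_shiftSet.2 hb)
  linarith

theorem IsNbhd.translate (hN : IsNbhd Φ (shiftSet x A) (shiftSet x N)) :
    IsNbhd (translate x Φ) A N := by
  refine ⟨(shiftSet_subset_shiftSet x).1 hN.1, fun C hC hCA => ?_⟩
  exact (shiftSet_subset_shiftSet x).1 (hN.2 _ (mt (translate_apply_eq_zero_iff x).2 hC)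
    (mt (Finset.disjoint_map _).1 hCA))

theorem translate_comm [NeZero d] (hΦ : IsLocal Φ) (Ψ : FormalOp d) :
    translate x (comm Φ Ψ) = comm (translate x Φ) (translate x Ψ) := by
  refine restrict_injective fun A => ?_
  obtain ⟨N, hN⟩ := hΦ.exists_isNbhd (shiftSet x A)
  obtain ⟨N, rfl⟩ := (bijective_shiftSet x).surjective N
  rw [restrict_comm (hΦ.translate x) _ hN.translate, restrict_translate, restrict_translate,
    restrict_translate, restrict_comm hΦ _ hN, pull_partialTrace, pull_lie]

theorem apply_apply_eq_of_eq (Φ : FormalOp d) {A A' : Finset ℤ} (h : A = A') (s t : Config d A) :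
    (Φ A : Op d A) s t = (Φ A' : Op d A') (fun a => s ⟨a, h ▸ a.2⟩) fun a => t ⟨a, h ▸ a.2⟩ := by
  subst h
  rfl

theorem translate_translate (Φ : FormalOp d) :
    translate x (translate y Φ) = translate (x + y) Φ := by
  funext A
  ext s t
  simp only [translate, Matrix.submatrix_apply]
  rw [apply_apply_eq_of_eq Φ (shiftSet_shiftSet x y A)]
  refine congrArg₂ _ (funext fun a => congrArg s (Subtype.ext ?_))
    (funext fun a => congrArg t (Subtype.ext ?_)) <;> simp [shiftEquiv] <;> ring

theorem translate_zero (Φ : FormalOp d) : translate 0 Φ = Φ := by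
  funext A
  ext s t
  simp only [translate, Matrix.submatrix_apply]
  rw [apply_apply_eq_of_eq Φ (shiftSet_zero A)]
  refine congrArg₂ _ (funext fun a => congrArg s (Subtype.ext ?_))
    (funext fun a => congrArg t (Subtype.ext ?_)) <;> simp [shiftEquiv]

theorem IsTranslationInvariant.translate_eq (h : IsTranslationInvariant Φ) :
    translate x Φ = Φ := by
  induction x using Int.induction_on with
  | zero => exact translate_zero Φ
  | succ n ih => rw [← translate_translate, show translate 1 Φ = Φ from h, ih]
  | pred n ih =>
    conv_lhs => rw [← show translate 1 Φ = Φ from h, translate_translate]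
    rwa [sub_add_cancel]

theorem adjoint_translate (Φ : FormalOp d) :
    adjoint (translate x Φ) = translate x (adjoint Φ) := rfl

theorem adjoint_sub (Φ Ψ : FormalOp d) : adjoint (Φ - Ψ) = adjoint Φ - adjoint Ψ :=
  funext fun _ => Subtype.ext (Matrix.conjTranspose_sub _ _)

theorem IsHermitian.translate_sub_self {B : FormalOp d} (hB : IsHermitian B) (x : ℤ) :
    IsHermitian (translate x B - B) := by
  rw [IsHermitian, adjoint_sub, adjoint_translate, hB]

variable (d) in
/-- The translation by one site `𝒯`, as an endomorphism of the Lie algebra of local formal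
operators. -/
def translateHom [NeZero d] : localOp d →ₗ⁅ℂ⁆ localOp d where
  toFun Φ := ⟨translate 1 Φ, Φ.2.translate 1⟩
  map_add' _ _ := rfl
  map_smul' _ _ := rfl
  map_lie' {Φ Ψ} := Subtype.ext (translate_comm 1 Φ.2 Ψ)

end Translate

section NormalizedTrace

variable {A B C : Finset ℤ}

/-- The normalized trace `d^{-|B|} Tr`, which is compatible with `embed` and `partialTrace`. -/
noncomputable def ntr : Op d B →ₗ[ℂ] ℂ :=
  ((d : ℂ) ^ B.card)⁻¹ • Matrix.traceLinearMap (Config d B) ℂ ℂ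

theorem ntr_apply (Y : Op d B) : ntr Y = ((d : ℂ) ^ B.card)⁻¹ * Y.trace := rfl

theorem ntr_mul_comm (X Y : Op d B) : ntr (X * Y) = ntr (Y * X) := by
  rw [ntr_apply, Matrix.trace_mul_comm, ntr_apply]

theorem ntr_lie (X Y : Op d B) : ntr ⁅X, Y⁆ = 0 := by
  rw [Ring.lie_def, map_sub, ntr_mul_comm, sub_self]

theorem ntr_conjTranspose (X : Op d B) : ntr Xᴴ = star (ntr X) := by
  simp [ntr_apply, Matrix.trace_conjTranspose]

theorem ntr_pull (x : ℤ) (Y : Op d (shiftSet x B)) : ntr (pull x B Y) = ntr Y := by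
  rw [ntr_apply, ntr_apply, show (shiftSet x B).card = B.card from Finset.card_map _]
  exact congrArg _ (((shiftEquiv x B).arrowCongr (Equiv.refl (Fin d))).sum_comp fun s => Y s s)

theorem ntr_partialTrace (h : A ⊆ B) (Y : Op d B) :
    ntr (partialTrace h Y) = ntr Y := by
  simp only [ntr_apply, Matrix.trace, Matrix.diag_apply, sum_split h, partialTrace,
    Matrix.of_apply, ← Finset.mul_sum]
  rw [← Finset.card_sdiff_add_card_eq_card h, pow_add, mul_inv]
  ring

theorem ntr_embed_mul (h : A ⊆ B) (X : Op d A) (Y : Op d B) :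
    ntr (embed h X * Y) = ntr (X * partialTrace h Y) := by
  rw [← ntr_partialTrace h, partialTrace_embed_mul]

open scoped ComplexOrder in
theorem ntr_conjTranspose_mul_self_eq_zero [NeZero d] {Y : Op d B} :
    ntr (Yᴴ * Y) = 0 ↔ Y = 0 := by
  rw [ntr_apply, mul_eq_zero_iff_left (inv_ne_zero (pow_ne_zero _ (NeZero.ne _))),
    Matrix.trace_conjTranspose_mul_self_eq_zero_iff]

theorem ntr_embed_mul_embed_eq_zero [NeZero d] (hA : A ⊆ B) (hC : C ⊆ B) (hne : A ≠ C)
    {X : Op d A} {Y : Op d C} (hX : X ∈ tracelessOp d A) (hY : Y ∈ tracelessOp d C) :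
    ntr (embed hA X * embed hC Y) = 0 := by
  by_cases hCA : C ⊆ A
  · rw [ntr_mul_comm, ntr_embed_mul,
      partialTrace_embed_traceless hA hC (fun hAC => hne (hAC.antisymm hCA)) hX, mul_zero, map_zero]
  · rw [ntr_embed_mul, partialTrace_embed_traceless hC hA hCA hY, mul_zero, map_zero]

theorem eq_zero_of_ntr_eq_zero {X : Op d ∅} (hX : ntr X = 0) : X = 0 := by
  ext s t
  rw [Subsingleton.elim t s]
  simpa [ntr_apply, Matrix.trace, Subsingleton.elim _ s] using hX

theorem comm_apply_empty [NeZero d] {Φ : FormalOp d} (hΦ : IsLocal Φ) (Ψ : FormalOp d) :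
    comm Φ Ψ ∅ = 0 := by
  obtain ⟨N, hN⟩ := hΦ.exists_isNbhd ∅
  have h_restrict : restrict (comm Φ Ψ) ∅ = 0 := eq_zero_of_ntr_eq_zero <| by
    rw [restrict_comm hΦ Ψ hN, ntr_partialTrace, ntr_lie]
  refine Subtype.ext ?_
  rw [← component_restrict _ Finset.Subset.rfl, h_restrict, component_zero, ZeroMemClass.coe_zero]

end NormalizedTrace

section Pairing

variable {A B N : Finset ℤ} {F G Φ Ψ H : FormalOp d}

/-- `Φ` is supported in `B`: it has no terms on sets that are not contained in `B`. -/
def IsSupportedIn (B : Finset ℤ) (Φ : FormalOp d) : Prop := ∀ A, Φ A ≠ 0 → A ⊆ B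

theorem IsSupportedIn.restrict_eq_embed (hF : IsSupportedIn B F) (h : B ⊆ N) :
    restrict F N = embed h (restrict F B) :=
  SpinChain.restrict_eq_embed h fun A _ => hF A

theorem IsSupportedIn.eq_zero [NeZero d] (hF : IsSupportedIn B F) (h : restrict F B = 0) :
    F = 0 := by
  funext A
  by_contra hA
  refine hA (Subtype.ext ?_)
  rw [← component_restrict F (hF A hA), h, component_zero, Pi.zero_apply, ZeroMemClass.coe_zero]

theorem IsSupportedIn.comm [NeZero d] (hH : IsLocal H) (hF : IsSupportedIn B F)
    (hN : IsNbhd H B N) : IsSupportedIn N (comm H F) := by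
  intro A hA
  obtain ⟨C, D, hC, hD, hCD, hACD⟩ := exists_of_comm_apply_ne_zero hH hA
  have hDB := hF D hD
  exact hACD.trans (Finset.union_subset
    (hN.2 C hC fun hCB => hCD (hCB.mono_right hDB)) (hDB.trans hN.1))

theorem IsSupportedIn.restrict_comm [NeZero d] (hH : IsLocal H) (hF : IsSupportedIn B F)
    (hB : B ⊆ N) : restrict (SpinChain.comm H F) N = ⁅restrict H N, restrict F N⁆ := by
  obtain ⟨M, hM⟩ := hH.exists_isNbhd N
  rw [SpinChain.restrict_comm hH F hM, hF.restrict_eq_embed (hB.trans hM.1),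
    ← embed_embed hB hM.1, ← hF.restrict_eq_embed hB, ← lie_skew, partialTrace_neg,
    partialTrace_embed_lie, partialTrace_restrict, lie_skew]

/-- The Hilbert–Schmidt pairing `⟨Φ, Ψ⟩ = ∑_A tr(Φ(A)† Ψ(A))` for the normalized trace `tr`. It is
meaningful when one of the two formal operators has finitely many terms. -/
noncomputable def pairing (Φ Ψ : FormalOp d) : ℂ :=
  ∑ᶠ A, ntr ((Φ A : Op d A)ᴴ * (Ψ A : Op d A))

theorem pairing_zero (Φ : FormalOp d) : pairing Φ 0 = 0 := by
  simp only [pairing, Pi.zero_apply, ZeroMemClass.coe_zero, mul_zero, map_zero, finsum_zero]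

theorem star_pairing (Φ Ψ : FormalOp d) : star (pairing Φ Ψ) = pairing Ψ Φ := by
  rw [pairing, ← starAddEquiv_apply, AddEquiv.map_finsum, pairing]
  refine finsum_congr fun A => ?_
  rw [starAddEquiv_apply, ← ntr_conjTranspose, Matrix.conjTranspose_mul,
    Matrix.conjTranspose_conjTranspose]

theorem pairing_translate (x : ℤ) (Φ Ψ : FormalOp d) :
    pairing (translate x Φ) (translate x Ψ) = pairing Φ Ψ := by
  simp only [pairing, translate_apply, ← pull_conjTranspose, ← map_mul, ntr_pull]
  exact finsum_comp (g := fun A => ntr ((Φ A : Op d A)ᴴ * (Ψ A : Op d A))) _ (bijective_shiftSet x)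

theorem pairing_translate_right (x : ℤ) (Φ Ψ : FormalOp d) :
    pairing Φ (translate x Ψ) = pairing (translate (-x) Φ) Ψ := by
  rw [← pairing_translate (-x), translate_translate, neg_add_cancel, translate_zero]

theorem pairing_eq_sum (hF : IsSupportedIn B F) (Ψ : FormalOp d) :
    pairing F Ψ = ∑ A ∈ B.powerset, ntr ((F A : Op d A)ᴴ * (Ψ A : Op d A)) := by
  refine finsum_eq_sum_of_support_subset _ fun A hA => ?_
  refine Finset.mem_coe.2 (Finset.mem_powerset.2 (hF A fun h => hA ?_))
  simp only [h, ZeroMemClass.coe_zero, Matrix.conjTranspose_zero, zero_mul, map_zero]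

theorem ntr_restrict_mul_embed [NeZero d] (h : A ⊆ B) (Φ : FormalOp d) {Y : Op d A}
    (hY : Y ∈ tracelessOp d A) :
    ntr ((restrict Φ B)ᴴ * embed h Y) = ntr ((Φ A : Op d A)ᴴ * Y) := by
  rw [← restrict_adjoint, restrict_eq_sum, Finset.sum_mul, map_sum,
    Finset.sum_eq_single_of_mem A (Finset.mem_powerset.2 h) fun C hC hne => ?_]
  · rw [dif_pos h, ntr_embed_mul, partialTrace_embed]
    rfl
  · rw [dif_pos (Finset.mem_powerset.1 hC)]
    exact ntr_embed_mul_embed_eq_zero _ h hne (adjoint Φ C).2 hY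

theorem pairing_eq_ntr [NeZero d] (hF : IsSupportedIn B F) (Ψ : FormalOp d) :
    pairing F Ψ = ntr ((restrict F B)ᴴ * restrict Ψ B) := by
  rw [pairing_eq_sum hF, restrict_eq_sum Ψ, Finset.mul_sum, map_sum]
  refine Finset.sum_congr rfl fun A hA => ?_
  rw [dif_pos (Finset.mem_powerset.1 hA), ntr_restrict_mul_embed _ F (Ψ A).2]

theorem IsSupportedIn.eq_zero_of_pairing_self [NeZero d] (hF : IsSupportedIn B F)
    (h : pairing F F = 0) : F = 0 :=
  hF.eq_zero (ntr_conjTranspose_mul_self_eq_zero.1 ((pairing_eq_ntr hF F).symm.trans h))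

theorem ntr_conjTranspose_mul_lie {K : Op d B} (hK : Kᴴ = K) (X Y : Op d B) :
    ntr (Xᴴ * ⁅K, Y⁆) = ntr (⁅K, X⁆ᴴ * Y) := by
  rw [Ring.lie_def, Ring.lie_def, Matrix.conjTranspose_sub, Matrix.conjTranspose_mul,
    Matrix.conjTranspose_mul, hK, mul_sub, sub_mul, map_sub, map_sub, ← mul_assoc, ← mul_assoc,
    ntr_mul_comm (Xᴴ * Y), ← mul_assoc]

theorem pairing_comm [NeZero d] (hH : IsLocal H) (hH' : IsHermitian H) (hF : IsSupportedIn B F)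
    (Ψ : FormalOp d) : pairing F (comm H Ψ) = pairing (comm H F) Ψ := by
  obtain ⟨N, hN⟩ := hH.exists_isNbhd B
  have hHN : (restrict H N)ᴴ = restrict H N := by rw [← restrict_adjoint, hH']
  rw [pairing_eq_ntr hF, restrict_comm hH Ψ hN, ← ntr_embed_mul, embed_conjTranspose,
    ← hF.restrict_eq_embed hN.1, ntr_conjTranspose_mul_lie hHN, ← hF.restrict_comm hH hN.1,
    ← pairing_eq_ntr (hF.comm hH hN)]

end Pairing

section Density

variable {A B : Finset ℤ} {F Φ Ψ H : FormalOp d}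

open Classical in
/-- The density of a translation-invariant formal operator: the part carried by the sets with least
element `0`, whose translates add up to the whole operator apart from the term on `∅`. -/
noncomputable def density (Φ : FormalOp d) : FormalOp d := fun A =>
  if IsLeast (A : Set ℤ) 0 then Φ A else 0

theorem isLeast_shiftSet_zero_iff {x : ℤ} (hA : A.Nonempty) :
    IsLeast (shiftSet x A : Set ℤ) 0 ↔ x = -A.min' hA := by
  have h_least : IsLeast (shiftSet x A : Set ℤ) (A.min' hA + x) :=
    ⟨add_mem_shiftSet.2 (A.min'_mem hA), fun a ha =>
      le_sub_iff_add_le.1 (A.min'_le _ (mem_shiftSet.1 ha))⟩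
  rw [eq_neg_iff_add_eq_zero, add_comm]
  exact ⟨h_least.unique, fun h => h ▸ h_least⟩

theorem translate_density_apply_of_ne (hA : A.Nonempty) {x : ℤ} (hx : x ≠ -A.min' hA) :
    translate x (density Φ) A = 0 := by
  rw [translate_apply_eq_zero_iff, density, if_neg (mt (isLeast_shiftSet_zero_iff hA).1 hx)]

theorem IsTranslationInvariant.translate_density_apply (hΦ : IsTranslationInvariant Φ)
    (hA : A.Nonempty) : translate (-A.min' hA) (density Φ) A = Φ A := by
  refine Subtype.ext ?_
  rw [translate_apply, density, if_pos ((isLeast_shiftSet_zero_iff hA).2 rfl), ← translate_apply,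
    hΦ.translate_eq]

theorem IsTranslationInvariant.eq_zero_of_density_eq_zero (hΦ : IsTranslationInvariant Φ)
    (hΦ_empty : Φ ∅ = 0) (h : density Φ = 0) : Φ = 0 := by
  funext A
  rcases A.eq_empty_or_nonempty with rfl | hA
  · exact hΦ_empty
  · rw [← hΦ.translate_density_apply hA, h]
    rfl

theorem IsLocal.exists_isSupportedIn_density (hΦ : IsLocal Φ) :
    ∃ B, IsSupportedIn B (density Φ) := by
  obtain ⟨r, hr⟩ := hΦ
  refine ⟨Finset.Icc 0 (r : ℤ), fun A hA a ha => ?_⟩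
  obtain ⟨hA_least, hA_ne⟩ := (@ite_ne_right_iff _ _ (Classical.dec _) _ _).1 hA
  have hra := hr A hA_ne 0 hA_least.1 a ha
  exact Finset.mem_Icc.2 ⟨hA_least.2 ha, by linarith⟩

theorem pairing_density_self (Φ : FormalOp d) :
    pairing (density Φ) (density Φ) = pairing (density Φ) Φ := by
  refine finsum_congr fun A => ?_
  by_cases hA : IsLeast (A : Set ℤ) 0
  · rw [density, if_pos hA]
  · simp only [density, if_neg hA, ZeroMemClass.coe_zero, Matrix.conjTranspose_zero, zero_mul]

theorem pairing_eq_finsum_translate_density (hF : IsSupportedIn B F) (hF_empty : F ∅ = 0)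
    (hΨ : IsTranslationInvariant Ψ) :
    pairing F Ψ = ∑ᶠ x, pairing F (translate x (density Ψ)) := by
  have h_off {A : Finset ℤ} (hA : A.Nonempty) {x : ℤ} (hx : x ≠ -A.min' hA) :
      ntr ((F A : Op d A)ᴴ * (translate x (density Ψ) A : Op d A)) = 0 := by
    rw [translate_density_apply_of_ne hA hx, ZeroMemClass.coe_zero, mul_zero, map_zero]
  have h_empty (Φ : FormalOp d) : ntr ((F ∅ : Op d ∅)ᴴ * (Φ ∅ : Op d ∅)) = 0 := by
    rw [hF_empty, ZeroMemClass.coe_zero, Matrix.conjTranspose_zero, zero_mul, map_zero]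
  simp only [pairing_eq_sum hF]
  rw [finsum_sum_comm]
  · refine Finset.sum_congr rfl fun A _ => ?_
    rcases A.eq_empty_or_nonempty with rfl | hA
    · simp only [h_empty, finsum_zero]
    · rw [finsum_eq_single _ (-A.min' hA) fun x => h_off hA, hΨ.translate_density_apply hA]
  · intro A _
    rcases A.eq_empty_or_nonempty with rfl | hA
    · simp only [h_empty, Function.hasFiniteSupport_zero]
    · exact (Set.finite_singleton (-A.min' hA)).subset fun x => not_imp_comm.1 (h_off hA)

theorem pairing_density_comm [NeZero d] (hH : IsLocal H) (hH' : IsHermitian H)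
    (hT : IsTranslationInvariant H) (hΦ : IsLocal Φ) (hΦT : IsTranslationInvariant Φ)
    (hΨ : IsLocal Ψ) (hΨT : IsTranslationInvariant Ψ) :
    pairing (density Φ) (comm H Ψ) = star (pairing (density Ψ) (comm H Φ)) := by
  obtain ⟨B, hB⟩ := hΦ.exists_isSupportedIn_density
  obtain ⟨C, hC⟩ := hΨ.exists_isSupportedIn_density
  obtain ⟨M, hM⟩ := hH.exists_isNbhd B
  obtain ⟨N, hN⟩ := hH.exists_isNbhd C
  have h_term (x : ℤ) : pairing (comm H (density Φ)) (translate x (density Ψ))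
      = star (pairing (comm H (density Ψ)) (translate (-x) (density Φ))) := by
    have h_comm : comm H (translate x (density Ψ)) = translate x (comm H (density Ψ)) := by
      rw [translate_comm x hH, hT.translate_eq]
    rw [← pairing_comm hH hH' hB, h_comm, pairing_translate_right, star_pairing]
  rw [pairing_comm hH hH' hB, pairing_comm hH hH' hC,
    pairing_eq_finsum_translate_density (hB.comm hH hM) (comm_apply_empty hH _) hΨT,
    pairing_eq_finsum_translate_density (hC.comm hH hN) (comm_apply_empty hH _) hΦT,
    finsum_congr h_term, ← starAddEquiv_apply, AddEquiv.map_finsum]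
  exact finsum_comp_equiv (Equiv.neg ℤ)
    (f := fun x => star (pairing (comm H (density Ψ)) (translate x (density Φ))))

theorem comm_eq_zero_of_comm_comm_eq_zero [NeZero d] (hH : IsLocal H) (hH' : IsHermitian H)
    (hT : IsTranslationInvariant H) (hΦ : IsLocal Φ) (hΦT : IsTranslationInvariant Φ)
    (h : comm H (comm H Φ) = 0) : comm H Φ = 0 := by
  have hL : IsLocal (comm H Φ) := hH.comm hΦ
  have hLT : IsTranslationInvariant (comm H Φ) := by
    rw [IsTranslationInvariant, translate_comm 1 hH, hT.translate_eq, hΦT.translate_eq]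
  obtain ⟨B, hB⟩ := hL.exists_isSupportedIn_density
  refine hLT.eq_zero_of_density_eq_zero (comm_apply_empty hH Φ) (hB.eq_zero_of_pairing_self ?_)
  rw [pairing_density_self, pairing_density_comm hH hH' hT hL hLT hΦ hΦT, h, pairing_zero,
    star_zero]

end Density

section Charges

variable [NeZero d]

theorem isAdReduced_translateHom (Φ : localOp d) (hΦ : IsHermitian Φ.1)
    (hT : IsTranslationInvariant Φ.1) : IsAdReduced (translateHom d) Φ := fun Ψ hΨ h =>
  Subtype.ext (comm_eq_zero_of_comm_comm_eq_zero Φ.2 hΦ hT Ψ.2 (congrArg Subtype.val hΨ)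
    (congrArg Subtype.val h))

theorem IsLocal.charge {H B : FormalOp d} (hH : IsLocal H) (hB : IsLocal B) (n : ℕ) :
    IsLocal (charge B H (n + 2)) := by
  induction n with
  | zero => exact hH
  | succ n ih => exact charge_succ B H (Nat.le_add_left 2 n) ▸ hB.comm ih

/-- The charges `Q⁽ⁿ⁺²⁾`, as elements of the Lie algebra of local formal operators. -/
noncomputable def localCharge (B H : localOp d) (n : ℕ) : localOp d :=
  ⟨charge B H (n + 2), H.2.charge B.2 n⟩

theorem localCharge_succ (B H : localOp d) (n : ℕ) :
    localCharge B H (n + 1) = ⁅B, localCharge B H n⁆ :=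
  Subtype.ext (charge_succ (B : FormalOp d) H (Nat.le_add_left 2 n))

end Charges

end SpinChain

theorem proposition2 (d : ℕ) [NeZero d] (H B X : SpinChain.FormalOp d)
    (hH_local : SpinChain.IsLocal H)
    (hH_herm : SpinChain.IsHermitian H)
    (hH_inv : SpinChain.IsTranslationInvariant H)
    (hB_local : SpinChain.IsLocal B)
    (hB_herm : SpinChain.IsHermitian B)
    (hX_def : X = SpinChain.translate 1 B - B)
    (hQ3 : SpinChain.comm H (SpinChain.charge B H 3) = 0)
    (hX_inv : SpinChain.IsTranslationInvariant X)
    (hXBX : SpinChain.comm X (SpinChain.comm B X) = 0) :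
    (∀ n : ℕ, 2 ≤ n → SpinChain.IsTranslationInvariant (SpinChain.charge B H n)) ∧
    (∀ m n : ℕ, 2 ≤ m → 2 ≤ n →
      SpinChain.comm (SpinChain.charge B H m) (SpinChain.charge B H n) = 0) ∧
    (∀ n : ℕ, 2 ≤ n → SpinChain.comm X (SpinChain.charge B H n) = 0) := by
  subst hX_def
  let b : SpinChain.localOp d := ⟨B, hB_local⟩
  let h : SpinChain.localOp d := ⟨H, hH_local⟩
  let T := SpinChain.translateHom d
  have hh : SpinChain.IsAdReduced T h := SpinChain.isAdReduced_translateHom h hH_herm hH_inv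
  have hx : SpinChain.IsAdReduced T (T b - b) :=
    SpinChain.isAdReduced_translateHom _ (hB_herm.translate_sub_self 1) hX_inv
  have hTh : T h = h := Subtype.ext hH_inv
  have hTx : T (T b - b) = T b - b := Subtype.ext hX_inv
  have hhbh : ⁅h, ⁅b, h⁆⁆ = 0 := Subtype.ext hQ3
  have hxbx : ⁅T b - b, ⁅b, T b - b⁆⁆ = 0 := Subtype.ext hXBX
  have hxh : ⁅T b - b, h⁆ = 0 := by
    rw [← lie_skew, hh.lie_sub_self_eq_zero hTh hTx hhbh, neg_zero]
  have hTq := hx.map_eq_and_lie_eq_zero hxbx (SpinChain.localCharge_succ b h) hTh hxh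
  have hqq := hh.lie_eq_zero (q := SpinChain.localCharge b h) (SpinChain.localCharge_succ b h)
    (fun n => (hTq n).1) hhbh
  simp only [le_iff_exists_add', forall_exists_index]
  refine ⟨?_, ?_, ?_⟩
  · rintro _ n rfl
    exact congrArg Subtype.val (hTq n).1
  · rintro _ _ m rfl n rfl
    exact congrArg Subtype.val (hqq m n)
  · rintro _ n rfl
    exact congrArg Subtype.val (hTq n).2
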